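/- Let $w:\mathbb{R}\to\mathbb{R}$ satisfy $w>0$ almost everywhere and $w\in L^1(\mathbb{R})\cap L^\infty(\mathbb{R})$. Let $L^2_w(\mathbb{R})$ be the Hilbert space of (classes of) complex functions with $\|f\|_w^2=\int_{\mathbb{R}}|f|^2w\,dx<\infty$, and put $Tf=-if'$, where $f'$ is the distributional derivative. Define $$D_0=\left\{f\in H^1(\mathbb{R})\ \big|\ w^{-1/2}Tf\in L^2(\mathbb{R})\right\},$$ and, for $\alpha\in\mathbb{C}$ with $|\alpha|=1$, $$D_1^\alpha=\left\{f\in L^2_w(\mathbb{R})\ \Big|\ f,f'\in L^1_{\mathrm{loc}}(\mathbb{R}),\ w^{-1}Tf\in L^2_w(\mathbb{R}),\ \lim_{x\to\infty}f(x)=\alpha\lim_{x\to-\infty}f(x)\right\},$$ where the limits are those of the continuous representative of $f$ and are required to exist. (1) The operator $T_w=w^{-1}T$ in $L^2_w(\mathbb{R})$ with domain $D_0$ is densely defined, symmetric and closable, and it is not essentially self-adjoint. Its closure $\overline{T_w}$ has deficiency index $(1,1)$, that is, $\dim\big(L^2_w(\mathbb{R})/\operatorname{Ran}(\overline{T_w}\mp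 i)\big)=1$ for both signs. (2) For every $\alpha\in\mathbb{C}$ with $|\alpha|=1$, the operator $T_w^\alpha=w^{-1}T$ in $L^2_w(\mathbb{R})$ with domain $D_1^\alpha$ is essentially self-adjoint. Its closure $H_w^\alpha$ is its unique self-adjoint extension, has compact resolvent, and has pure point spectrum: every point of its spectrum is an eigenvalue, and its eigenfunctions span a dense subspace of $L^2_w(\mathbb{R})$. If $\alpha=e^{i\beta}$ with $\beta\in\mathbb{R}$, then the spectrum of $H_w^\alpha$ is $$\left\{\|w\|_{L^1(\mathbb{R})}^{-1}(\beta+2\pi k)\ \big|\ k\in\mathbb{Z}\right\}.$$ -/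

import Mathlib

open MeasureTheory Filter Topology
open scoped ENNReal ContDiff

noncomputable section

namespace WeightedMomentum

/-! ### Unbounded operators on a Hilbert space -/

section Operators

variable {H : Type*} [NormedAddCommGroup H] [InnerProductSpace ℂ H]

/-- Symmetry on the domain: `⟪A x, y⟫ = ⟪x, A y⟫` for all `x, y` in the domain of `A`. -/
def IsSymm (A : H →ₗ.[ℂ] H) : Prop :=
  ∀ x y : A.domain, inner ℂ (A x) (y : H) = inner ℂ (x : H) (A y)

/-- `A` is essentially self-adjoint: it has a closure, and the closure is self-adjoint. -/
def IsEssentiallySelfAdjoint [CompleteSpace H] (A : H →ₗ.[ℂ] H) : Prop :=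
  A.IsClosable ∧ IsSelfAdjoint A.closure

/-- The operator `A - z`, with the same domain as `A`. -/
def shift (A : H →ₗ.[ℂ] H) (z : ℂ) : H →ₗ.[ℂ] H where
  domain := A.domain
  toFun := A.toFun - z • A.domain.subtype

/-- The deficiency of `A`: the dimension of `H / Ran A`. -/
def deficiency (A : H →ₗ.[ℂ] H) : Cardinal :=
  Module.rank ℂ (H ⧸ LinearMap.range A.toFun)

/-- The deficiency index `(def (Ā - i), def (Ā + i))` of a closable symmetric operator `A`
with closure `Ā`. -/
def deficiencyIndex (A : H →ₗ.[ℂ] H) : Cardinal × Cardinal :=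
  (deficiency (shift A.closure Complex.I), deficiency (shift A.closure (-Complex.I)))

/-- The bounded operator `R` is a two-sided inverse of `A - z`. -/
def IsResolventAt (A : H →ₗ.[ℂ] H) (z : ℂ) (R : H →L[ℂ] H) : Prop :=
  (∀ y : H, ∃ x : A.domain, (x : H) = R y ∧ A x - z • (x : H) = y) ∧
    ∀ x : A.domain, R (A x - z • (x : H)) = x

/-- The spectrum of an unbounded operator. -/
def opSpectrum (A : H →ₗ.[ℂ] H) : Set ℂ :=
  {z | ¬ ∃ R : H →L[ℂ] H, IsResolventAt A z R}

/-- The eigenspace of `A` for `z`, as a set of vectors of `H`. -/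
def eigenvectors (A : H →ₗ.[ℂ] H) (z : ℂ) : Set H :=
  {v | ∃ x : A.domain, (x : H) = v ∧ A x = z • (x : H)}

/-- The set of eigenvalues of `A`. -/
def pointSpectrum (A : H →ₗ.[ℂ] H) : Set ℂ :=
  {z | ∃ v ∈ eigenvectors A z, v ≠ 0}

/-- The resolvent set is not empty and `(A - z)⁻¹` is compact for every `z` in it. -/
def HasCompactResolvent (A : H →ₗ.[ℂ] H) : Prop :=
  (opSpectrum A)ᶜ.Nonempty ∧
    ∀ (z : ℂ) (R : H →L[ℂ] H), IsResolventAt A z R → IsCompactOperator R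

/-- The spectrum consists of eigenvalues only, and the linear span of the eigenvectors
is dense. -/
def HasPurePointSpectrum (A : H →ₗ.[ℂ] H) : Prop :=
  opSpectrum A = pointSpectrum A ∧
    Dense (Submodule.span ℂ (⋃ z : ℂ, eigenvectors A z) : Set H)

end Operators

/-! ### Weak derivatives on the line -/

/-- `f'` is the distributional derivative of `f` on `ℝ` (both locally integrable). -/
def HasWeakDeriv (f f' : ℝ → ℂ) : Prop :=
  LocallyIntegrable f ∧ LocallyIntegrable f' ∧
    ∀ φ : ℝ → ℝ, ContDiff ℝ ∞ φ → HasCompactSupport φ →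
      ∫ x, deriv φ x • f x = - ∫ x, φ x • f' x

/-- `f` and its distributional derivative are locally integrable functions. -/
def WeaklyDifferentiable (f : ℝ → ℂ) : Prop :=
  ∃ f' : ℝ → ℂ, HasWeakDeriv f f'

open Classical in
/-- The distributional derivative of `f`, unique up to a null set (`0` if there is none). -/
def weakDeriv (f : ℝ → ℂ) : ℝ → ℂ :=
  if h : WeaklyDifferentiable f then h.choose else 0

/-- `T f = -i f'`, with the distributional derivative. -/
def momentum (f : ℝ → ℂ) : ℝ → ℂ :=
  fun x => -Complex.I * weakDeriv f x

/-- `f ∈ H¹(ℝ)`: `f` and its distributional derivative are in `L²(ℝ)`. -/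
def MemH1 (f : ℝ → ℂ) : Prop :=
  MemLp f 2 ∧ WeaklyDifferentiable f ∧ MemLp (weakDeriv f) 2

theorem WeaklyDifferentiable.hasWeakDeriv {f : ℝ → ℂ} (h : WeaklyDifferentiable f) :
    HasWeakDeriv f (weakDeriv f) := by
  rw [weakDeriv, dif_pos h]
  exact h.choose_spec

theorem HasWeakDeriv.unique {f f₁ f₂ : ℝ → ℂ} (h₁ : HasWeakDeriv f f₁)
    (h₂ : HasWeakDeriv f f₂) : f₁ =ᵐ[volume] f₂ := by
  refine ae_eq_of_integral_contDiff_smul_eq h₁.2.1 h₂.2.1 fun φ hφ hc => ?_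
  have e := (h₁.2.2 φ hφ hc).symm.trans (h₂.2.2 φ hφ hc)
  exact neg_injective e

theorem HasWeakDeriv.weakDeriv_ae {f g : ℝ → ℂ} (h : HasWeakDeriv f g) :
    weakDeriv f =ᵐ[volume] g :=
  (WeaklyDifferentiable.hasWeakDeriv ⟨g, h⟩).unique h

theorem HasWeakDeriv.congr {f g f' : ℝ → ℂ} (h : HasWeakDeriv f f') (e : f =ᵐ[volume] g) :
    HasWeakDeriv g f' := by
  refine ⟨h.1.congr e, h.2.1, fun φ hφ hc => ?_⟩
  rw [← h.2.2 φ hφ hc]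
  refine integral_congr_ae ?_
  filter_upwards [e] with x hx
  rw [hx]

theorem HasWeakDeriv.zero : HasWeakDeriv 0 0 :=
  ⟨locallyIntegrable_zero, locallyIntegrable_zero, by simp⟩

theorem HasWeakDeriv.add {f g f' g' : ℝ → ℂ} (hf : HasWeakDeriv f f')
    (hg : HasWeakDeriv g g') : HasWeakDeriv (f + g) (f' + g') := by
  refine ⟨hf.1.add hg.1, hf.2.1.add hg.2.1, fun φ hφ hc => ?_⟩
  have hd : Continuous (deriv φ) := hφ.continuous_deriv (by simp)
  simp only [Pi.add_apply, smul_add]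
  rw [integral_add (hf.1.integrable_smul_left_of_hasCompactSupport hd hc.deriv)
      (hg.1.integrable_smul_left_of_hasCompactSupport hd hc.deriv),
    integral_add (hf.2.1.integrable_smul_left_of_hasCompactSupport hφ.continuous hc)
      (hg.2.1.integrable_smul_left_of_hasCompactSupport hφ.continuous hc),
    hf.2.2 φ hφ hc, hg.2.2 φ hφ hc, neg_add]

theorem HasWeakDeriv.const_smul {f f' : ℝ → ℂ} (c : ℂ) (hf : HasWeakDeriv f f') :
    HasWeakDeriv (c • f) (c • f') := by
  refine ⟨hf.1.smul c, hf.2.1.smul c, fun φ hφ hc => ?_⟩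
  simp only [Pi.smul_apply, smul_comm _ c]
  rw [integral_smul, integral_smul, hf.2.2 φ hφ hc, smul_neg]

/-! ### The weighted space -/

/-- The weights `0 < w ∈ L¹(ℝ) ∩ L^∞(ℝ)`. -/
structure IsWeight (w : ℝ → ℝ) : Prop where
  pos : ∀ᵐ x, 0 < w x
  integrable : Integrable w
  bounded : MemLp w ∞

/-- The measure `w(x) dx`. -/
def weightedMeasure (w : ℝ → ℝ) : Measure ℝ :=
  volume.withDensity fun x => ENNReal.ofReal (w x)

/-- The Hilbert space `L²_w(ℝ)` of complex functions, with norm `(∫ |f|² w dx)^{1/2}`. -/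
abbrev L2w (w : ℝ → ℝ) : Type := Lp ℂ 2 (weightedMeasure w)

variable {w : ℝ → ℝ}

theorem IsWeight.aemeasurable (hw : IsWeight w) :
    AEMeasurable (fun x => ENNReal.ofReal (w x)) :=
  hw.integrable.aestronglyMeasurable.aemeasurable.ennreal_ofReal

theorem weightedMeasure_ac : weightedMeasure w ≪ volume :=
  withDensity_absolutelyContinuous _ _

theorem IsWeight.ae_iff (hw : IsWeight w) {p : ℝ → Prop}
    (h : ∀ᵐ x ∂weightedMeasure w, p x) : ∀ᵐ x, p x := by
  rw [weightedMeasure, ae_withDensity_iff' hw.aemeasurable] at h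
  filter_upwards [h, hw.pos] with x hx hp
  exact hx (by simpa using hp)

theorem IsWeight.coeFn_zero (hw : IsWeight w) : ((0 : L2w w) : ℝ → ℂ) =ᵐ[volume] 0 :=
  hw.ae_iff (Lp.coeFn_zero ℂ 2 (weightedMeasure w))

theorem IsWeight.coeFn_add (hw : IsWeight w) (u v : L2w w) :
    ((u + v : L2w w) : ℝ → ℂ) =ᵐ[volume] u + v :=
  hw.ae_iff (Lp.coeFn_add u v)

theorem IsWeight.coeFn_smul (hw : IsWeight w) (c : ℂ) (u : L2w w) :
    ((c • u : L2w w) : ℝ → ℂ) =ᵐ[volume] c • (u : ℝ → ℂ) :=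
  hw.ae_iff (Lp.coeFn_smul c u)

theorem IsWeight.weaklyDiff_zero (hw : IsWeight w) :
    HasWeakDeriv ((0 : L2w w) : ℝ → ℂ) 0 :=
  HasWeakDeriv.zero.congr hw.coeFn_zero.symm

theorem IsWeight.weaklyDiff_add (hw : IsWeight w) {u v : L2w w}
    (hu : WeaklyDifferentiable u) (hv : WeaklyDifferentiable v) :
    HasWeakDeriv ((u + v : L2w w) : ℝ → ℂ) (weakDeriv u + weakDeriv v) :=
  (hu.hasWeakDeriv.add hv.hasWeakDeriv).congr (hw.coeFn_add u v).symm

theorem IsWeight.weaklyDiff_smul (hw : IsWeight w) (c : ℂ) {u : L2w w}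
    (hu : WeaklyDifferentiable u) :
    HasWeakDeriv ((c • u : L2w w) : ℝ → ℂ) (c • weakDeriv u) :=
  (hu.hasWeakDeriv.const_smul c).congr (hw.coeFn_smul c u).symm

theorem IsWeight.momentum_zero (hw : IsWeight w) :
    momentum ((0 : L2w w) : ℝ → ℂ) =ᵐ[volume] 0 := by
  filter_upwards [hw.weaklyDiff_zero.weakDeriv_ae] with x hx
  simp only [momentum, hx, Pi.zero_apply, mul_zero]

theorem IsWeight.momentum_add (hw : IsWeight w) {u v : L2w w}
    (hu : WeaklyDifferentiable u) (hv : WeaklyDifferentiable v) :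
    momentum ((u + v : L2w w) : ℝ → ℂ) =ᵐ[volume] momentum u + momentum v := by
  filter_upwards [(hw.weaklyDiff_add hu hv).weakDeriv_ae] with x hx
  simp only [momentum, hx, Pi.add_apply, mul_add]

theorem IsWeight.momentum_smul (hw : IsWeight w) (c : ℂ) {u : L2w w}
    (hu : WeaklyDifferentiable u) :
    momentum ((c • u : L2w w) : ℝ → ℂ) =ᵐ[volume] c • momentum u := by
  filter_upwards [(hw.weaklyDiff_smul c hu).weakDeriv_ae] with x hx
  simp only [momentum, hx, Pi.smul_apply, smul_eq_mul]
  ring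

/-! ### The domains and the operators -/

/-- The function `w⁻¹ T f`. -/
def weightedMomentum (w : ℝ → ℝ) (f : ℝ → ℂ) : ℝ → ℂ :=
  fun x => ((w x)⁻¹ : ℝ) * momentum f x

theorem IsWeight.memLp_zero (hw : IsWeight w) {μ : Measure ℝ} (hμ : μ ≪ volume) (m : ℝ → ℂ) :
    MemLp (fun x => m x * momentum ((0 : L2w w) : ℝ → ℂ) x) 2 μ := by
  refine (MemLp.zero (p := 2) (μ := μ) (ε := ℂ)).ae_eq ?_
  filter_upwards [hμ.ae_le hw.momentum_zero] with x hx
  simp only [hx, Pi.zero_apply, mul_zero]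

theorem IsWeight.memLp_add (hw : IsWeight w) {μ : Measure ℝ} (hμ : μ ≪ volume) (m : ℝ → ℂ)
    {u v : L2w w} (hu : WeaklyDifferentiable u) (hv : WeaklyDifferentiable v)
    (hu' : MemLp (fun x => m x * momentum u x) 2 μ)
    (hv' : MemLp (fun x => m x * momentum v x) 2 μ) :
    MemLp (fun x => m x * momentum ((u + v : L2w w) : ℝ → ℂ) x) 2 μ := by
  refine (hu'.add hv').ae_eq ?_
  filter_upwards [hμ.ae_le (hw.momentum_add hu hv)] with x hx
  simp only [hx, Pi.add_apply, mul_add]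

theorem IsWeight.memLp_smul (hw : IsWeight w) {μ : Measure ℝ} (hμ : μ ≪ volume) (m : ℝ → ℂ)
    (c : ℂ) {u : L2w w} (hu : WeaklyDifferentiable u)
    (hu' : MemLp (fun x => m x * momentum u x) 2 μ) :
    MemLp (fun x => m x * momentum ((c • u : L2w w) : ℝ → ℂ) x) 2 μ := by
  refine (hu'.const_smul c).ae_eq ?_
  filter_upwards [hμ.ae_le (hw.momentum_smul c hu)] with x hx
  simp only [hx, Pi.smul_apply, smul_eq_mul, mul_left_comm]

/-- The maximal domain `{f ∈ L²_w(ℝ) | w⁻¹ T f ∈ L²_w(ℝ)}`. -/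
def maxDomain (hw : IsWeight w) : Submodule ℂ (L2w w) where
  carrier := {u | WeaklyDifferentiable u ∧
    MemLp (weightedMomentum w u) 2 (weightedMeasure w)}
  zero_mem' := ⟨⟨0, hw.weaklyDiff_zero⟩, hw.memLp_zero weightedMeasure_ac _⟩
  add_mem' hu hv := ⟨⟨_, hw.weaklyDiff_add hu.1 hv.1⟩,
    hw.memLp_add weightedMeasure_ac _ hu.1 hv.1 hu.2 hv.2⟩
  smul_mem' c _ hu := ⟨⟨_, hw.weaklyDiff_smul c hu.1⟩,
    hw.memLp_smul weightedMeasure_ac _ c hu.1 hu.2⟩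

/-- The domain `D₀ = {f ∈ H¹(ℝ) | w^{-1/2} T f ∈ L²(ℝ)}`. -/
def D0 (hw : IsWeight w) : Submodule ℂ (L2w w) where
  carrier := {u | MemH1 u ∧ MemLp (fun x => ((w x ^ (-(1 / 2) : ℝ) : ℝ) : ℂ) * momentum u x) 2}
  zero_mem' := by
    refine ⟨⟨?_, ⟨0, hw.weaklyDiff_zero⟩, ?_⟩, hw.memLp_zero .rfl _⟩
    · exact (MemLp.zero (p := 2) (μ := volume) (ε := ℂ)).ae_eq hw.coeFn_zero.symm
    · exact (MemLp.zero (p := 2) (μ := volume) (ε := ℂ)).ae_eq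
        hw.weaklyDiff_zero.weakDeriv_ae.symm
  add_mem' hu hv := by
    obtain ⟨⟨hu1, hu2, hu3⟩, hu4⟩ := hu
    obtain ⟨⟨hv1, hv2, hv3⟩, hv4⟩ := hv
    refine ⟨⟨?_, ⟨_, hw.weaklyDiff_add hu2 hv2⟩, ?_⟩, hw.memLp_add .rfl _ hu2 hv2 hu4 hv4⟩
    · exact (hu1.add hv1).ae_eq (hw.coeFn_add _ _).symm
    · exact (hu3.add hv3).ae_eq (hw.weaklyDiff_add hu2 hv2).weakDeriv_ae.symm
  smul_mem' c u hu := by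
    obtain ⟨⟨hu1, hu2, hu3⟩, hu4⟩ := hu
    refine ⟨⟨?_, ⟨_, hw.weaklyDiff_smul c hu2⟩, ?_⟩, hw.memLp_smul .rfl _ c hu2 hu4⟩
    · exact (hu1.const_smul c).ae_eq (hw.coeFn_smul c u).symm
    · exact (hu3.const_smul c).ae_eq (hw.weaklyDiff_smul c hu2).weakDeriv_ae.symm

/-- The twisted boundary condition `f(∞) = α f(-∞)`: the continuous representative of `f`
has limits at `±∞`, and `lim_{x → ∞} f(x) = α lim_{x → -∞} f(x)`. -/
def TwistedLimits (α : ℂ) (f : ℝ → ℂ) : Prop :=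
  ∃ g : ℝ → ℂ, Continuous g ∧ f =ᵐ[volume] g ∧
    ∃ l : ℂ, Tendsto g atBot (𝓝 l) ∧ Tendsto g atTop (𝓝 (α * l))

/-- The domain
`D₁^α = {f ∈ L²_w(ℝ) | w⁻¹ T f ∈ L²_w(ℝ), lim_{x → ∞} f(x) = α lim_{x → -∞} f(x)}`. -/
def D1 (hw : IsWeight w) (α : ℂ) : Submodule ℂ (L2w w) where
  carrier := {u | u ∈ maxDomain hw ∧ TwistedLimits α u}
  zero_mem' := ⟨zero_mem _, 0, continuous_zero, hw.coeFn_zero, 0, tendsto_const_nhds,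
    (mul_zero α).symm ▸ tendsto_const_nhds⟩
  add_mem' := by
    rintro u v ⟨hu, g, hg, eg, l, lg, lg'⟩ ⟨hv, k, hk, ek, m, mk, mk'⟩
    refine ⟨add_mem hu hv, g + k, hg.add hk, (hw.coeFn_add u v).trans (eg.add ek), l + m,
      lg.add mk, ?_⟩
    rw [mul_add]
    exact lg'.add mk'
  smul_mem' := by
    rintro c u ⟨hu, g, hg, eg, l, lg, lg'⟩
    refine ⟨Submodule.smul_mem _ c hu, c • g, hg.const_smul c,
      (hw.coeFn_smul c u).trans (eg.const_smul c), c • l, lg.const_smul c, ?_⟩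
    rw [mul_smul_comm]
    exact lg'.const_smul c

theorem D0_le_maxDomain (hw : IsWeight w) : D0 hw ≤ maxDomain hw := by
  rintro u ⟨⟨-, hd, -⟩, h⟩
  refine ⟨hd, ?_⟩
  have hwm : AEMeasurable w := hw.integrable.aestronglyMeasurable.aemeasurable
  have hm : AEStronglyMeasurable (weightedMomentum w u) volume := by
    have h1 : AEStronglyMeasurable (fun x => (((w x)⁻¹ : ℝ) : ℂ)) volume :=
      (Complex.measurable_ofReal.comp_aemeasurable hwm.inv).aestronglyMeasurable
    exact h1.mul (hd.hasWeakDeriv.2.1.aestronglyMeasurable.const_mul (-Complex.I))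
  refine ⟨hm.mono_ac weightedMeasure_ac, ?_⟩
  rw [eLpNorm_lt_top_iff_lintegral_rpow_enorm_lt_top (by norm_num) (by norm_num)]
  have h2 := (eLpNorm_lt_top_iff_lintegral_rpow_enorm_lt_top
    (by norm_num) (by norm_num)).1 h.2
  refine lt_of_eq_of_lt ?_ h2
  refine (lintegral_withDensity_eq_lintegral_mul₀ hw.aemeasurable
    (hm.enorm.pow_const _)).trans ?_
  refine lintegral_congr_ae ?_
  filter_upwards [hw.pos] with x hx
  have e1 : ∀ z : ℂ, ‖z‖ₑ ^ (2 : ℝ) = ENNReal.ofReal (‖z‖ ^ 2) := fun z => by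
    rw [← ofReal_norm, ENNReal.ofReal_rpow_of_nonneg (norm_nonneg _) (by norm_num)]
    norm_num
  have e2 : (w x ^ (-(1 / 2) : ℝ)) ^ 2 = (w x)⁻¹ := by
    rw [← Real.rpow_natCast, ← Real.rpow_mul hx.le]
    norm_num [Real.rpow_neg_one]
  simp only [Pi.mul_apply, ENNReal.toReal_ofNat, e1, weightedMomentum]
  rw [← ENNReal.ofReal_mul hx.le, norm_mul, norm_mul, mul_pow, mul_pow, Complex.norm_real,
    Complex.norm_real, Real.norm_eq_abs, Real.norm_eq_abs, sq_abs, sq_abs, e2]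
  congr 1
  field_simp

theorem D1_le_maxDomain (hw : IsWeight w) (α : ℂ) : D1 hw α ≤ maxDomain hw :=
  fun _ h => h.1

/-- The operator `f ↦ w⁻¹ T f` in `L²_w(ℝ)` on the maximal domain. -/
def maxOp (hw : IsWeight w) : L2w w →ₗ.[ℂ] L2w w where
  domain := maxDomain hw
  toFun :=
    { toFun := fun u => MemLp.toLp (weightedMomentum w (u : L2w w)) u.2.2
      map_add' := fun u v => by
        rw [← MemLp.toLp_add]
        refine MemLp.toLp_congr _ _ ?_
        filter_upwards [weightedMeasure_ac.ae_le (hw.momentum_add u.2.1 v.2.1)] with x hx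
        simp only [weightedMomentum, Submodule.coe_add, Pi.add_apply] at hx ⊢
        rw [hx, mul_add]
      map_smul' := fun c u => by
        rw [RingHom.id_apply, ← MemLp.toLp_const_smul]
        refine MemLp.toLp_congr _ _ ?_
        filter_upwards [weightedMeasure_ac.ae_le (hw.momentum_smul c u.2.1)] with x hx
        simp only [weightedMomentum, Submodule.coe_smul, Pi.smul_apply, smul_eq_mul] at hx ⊢
        rw [hx, mul_left_comm] }

/-- The operator `T_w = w⁻¹ T` with domain `D₀`. -/
def Tw (hw : IsWeight w) : L2w w →ₗ.[ℂ] L2w w where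
  domain := D0 hw
  toFun := (maxOp hw).toFun ∘ₗ Submodule.inclusion (D0_le_maxDomain hw)

/-- The operator `T_w^α = w⁻¹ T` with domain `D₁^α`. -/
def TwTwisted (hw : IsWeight w) (α : ℂ) : L2w w →ₗ.[ℂ] L2w w where
  domain := D1 hw α
  toFun := (maxOp hw).toFun ∘ₗ Submodule.inclusion (D1_le_maxDomain hw α)

end WeightedMomentum

end

/-! Let `μ = w dx`, a finite measure without atoms that charges every nonempty open set, with
distribution function `F` and total mass `m = ‖w‖₁`. The equation `w⁻¹ T u = g` means `u' = i w g`,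
so its solutions are `u = c + i V g`, where `V` is the Volterra operator `g ↦ ∫_{(-∞, x]} g dμ` on
`L²(μ)` and `c` is the limit of `u` at `-∞` (`IsWeight.mem_graph_maxOp`). The unbounded operators
thus become conditions on the pair `(c, g)`. The twisted boundary condition reads `(α - 1) c = i ⟪1,
g⟫`. Membership in `D₀` forces `c = 0` and `⟪1, g⟫ = 0`, and these two equations describe exactly
the closure of `T_w` (`IsWeight.mem_closure_graph_Tw_iff`).

Three facts about `V` carry the proof. Fubini's theorem gives `V + V* = ⟪1, ·⟫ 1`
(`inner_volterra_add`), hence symmetry when `|α| = 1` and density of `D₀`. `V` is a norm limit of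
finite rank operators, hence compact, and it has no nonzero eigenvalue, so `1 - i z V` is invertible
for every `z` (`exists_equiv_one_sub_volterra`). Finally `E_z = exp (i z F)` solves `E_z = 1 + i z V
E_z` (`expL2_eq`).

Consequently every solution of `T_w^α u = z u` is a multiple of `E_z`, and `E_z` satisfies the
boundary condition iff `exp (i z m) = α`. For all other `z` there is an explicit compact resolvent
(`IsWeight.exists_resolvent`). Symmetry together with a resolvent at a real point makes `T_w^α`
itself self-adjoint, and the spectral theorem for compact operators gives the density of the
eigenvectors. The range of the closure of `T_w` minus `z` is the image of the hyperplane `1^⊥` under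
`1 - i z V`, so it has codimension one. -/

namespace WeightedMomentum

/-! ### Primitives with respect to a measure without atoms -/

section Primitive

variable {μ : Measure ℝ}

/-- The primitive `x ↦ ∫_{(-∞, x]} f dμ`. -/
noncomputable def prim (μ : Measure ℝ) (f : ℝ → ℂ) (x : ℝ) : ℂ :=
  ∫ y in Set.Iic x, f y ∂μ

theorem prim_congr {f g : ℝ → ℂ} (h : f =ᵐ[μ] g) : prim μ f = prim μ g :=
  funext fun _ => integral_congr_ae (ae_restrict_of_ae h)

theorem prim_add {f g : ℝ → ℂ} (hf : Integrable f μ) (hg : Integrable g μ) (x : ℝ) :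
    prim μ (fun y => f y + g y) x = prim μ f x + prim μ g x :=
  integral_add hf.integrableOn hg.integrableOn

theorem prim_sub {f g : ℝ → ℂ} (hf : Integrable f μ) (hg : Integrable g μ) (x : ℝ) :
    prim μ (fun y => f y - g y) x = prim μ f x - prim μ g x :=
  integral_sub hf.integrableOn hg.integrableOn

theorem prim_const_mul (c : ℂ) (f : ℝ → ℂ) (x : ℝ) :
    prim μ (fun y => c * f y) x = c * prim μ f x :=
  integral_const_mul c f

theorem norm_prim_le {f : ℝ → ℂ} (hf : Integrable f μ) (x : ℝ) :
    ‖prim μ f x‖ ≤ ∫ y, ‖f y‖ ∂μ :=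
  (norm_integral_le_integral_norm _).trans
    (setIntegral_le_integral hf.norm (ae_of_all _ fun _ => norm_nonneg _))

theorem continuous_prim [NullSingletonClass μ] {f : ℝ → ℂ} (hf : Integrable f μ) :
    Continuous (prim μ f) := by
  have : prim μ f = fun x => prim μ f 0 + ∫ y in (0 : ℝ)..x, f y ∂μ := by
    funext x
    rw [← intervalIntegral.integral_Iic_sub_Iic hf.integrableOn hf.integrableOn]
    simp [prim]
  rw [this]
  exact continuous_const.add (hf.continuous_primitive 0)

theorem tendsto_prim_atTop {f : ℝ → ℂ} (hf : Integrable f μ) :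
    Tendsto (prim μ f) atTop (𝓝 (∫ y, f y ∂μ)) :=
  (aecover_Iic tendsto_id).integral_tendsto_of_countably_generated hf

theorem tendsto_prim_atBot {f : ℝ → ℂ} (hf : Integrable f μ) :
    Tendsto (prim μ f) atBot (𝓝 0) := by
  have h := (aecover_Ioi (μ := μ) (l := atBot) (a := id)
    tendsto_id).integral_tendsto_of_countably_generated hf
  have e : prim μ f = fun x => (∫ y, f y ∂μ) - ∫ y in Set.Ioi x, f y ∂μ := by
    funext x
    rw [prim, eq_sub_iff_add_eq, ← Set.compl_Iic]
    exact integral_add_compl measurableSet_Iic hf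
  rw [e, ← sub_self (∫ y, f y ∂μ)]
  exact h.const_sub _

/-- Integration by parts for two primitives. -/
theorem integral_mul_integral [SFinite μ] [NullSingletonClass μ] {f g : ℝ → ℂ}
    (hf : Integrable f μ) (hg : Integrable g μ) :
    (∫ y, f y ∂μ) * ∫ y, g y ∂μ
      = (∫ y, f y * prim μ g y ∂μ) + ∫ y, g y * prim μ f y ∂μ := by
  have hfg : Integrable (fun z : ℝ × ℝ => f z.1 * g z.2) (μ.prod μ) := hf.mul_prod hg
  have hA : MeasurableSet {z : ℝ × ℝ | z.2 ≤ z.1} := measurableSet_le measurable_snd measurable_fst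
  -- The product is an integral over the plane, split along the diagonal; each half is integrated in
  -- the order that produces an inner primitive.
  rw [← integral_prod_mul, ← integral_add_compl hA hfg, ← integral_indicator hA,
    ← integral_indicator hA.compl, integral_prod _ (hfg.indicator hA),
    integral_prod_symm _ (hfg.indicator hA.compl)]
  congr 1
  · refine integral_congr_ae (ae_of_all _ fun x => ?_)
    change _ = f x * ∫ y in Set.Iic x, g y ∂μ
    rw [← integral_const_mul, ← integral_indicator measurableSet_Iic]
    rfl
  · refine integral_congr_ae (ae_of_all _ fun y => ?_)
    change _ = g y * ∫ x in Set.Iic y, f x ∂μ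
    -- The complement of the closed half-plane yields open half-lines; without atoms the endpoint
    -- does not matter.
    rw [setIntegral_congr_set Iio_ae_eq_Iic.symm, ← integral_const_mul,
      ← integral_indicator measurableSet_Iio]
    refine integral_congr_ae (ae_of_all _ fun x => ?_)
    by_cases h : x < y <;> simp [Set.indicator, h, mul_comm]

theorem Integrable.mul_prim [NullSingletonClass μ] {f g : ℝ → ℂ}
    (hf : Integrable f μ) (hg : Integrable g μ) :
    Integrable (fun y => f y * prim μ g y) μ :=
  hf.mul_bdd (continuous_prim hg).aestronglyMeasurable
    (ae_of_all _ fun x => norm_prim_le hg x)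

/-- The product rule in integrated form: `integral_mul_integral` for `μ` restricted to `(-∞, x]`,
where primitives at points `y ≤ x` are unchanged. -/
theorem prim_mul_prim [SFinite μ] [NullSingletonClass μ] {f g : ℝ → ℂ}
    (hf : Integrable f μ) (hg : Integrable g μ) (x : ℝ) :
    prim μ f x * prim μ g x
      = prim μ (fun y => f y * prim μ g y) x + prim μ (fun y => g y * prim μ f y) x := by
  have h := integral_mul_integral (hf.integrableOn (s := Set.Iic x))
    (hg.integrableOn (s := Set.Iic x))
  have e : ∀ k : ℝ → ℂ, ∀ y ∈ Set.Iic x, prim (μ.restrict (Set.Iic x)) k y = prim μ k y := by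
    intro k y hy
    rw [prim, prim, Measure.restrict_restrict measurableSet_Iic, Set.Iic_inter_Iic,
      min_eq_left hy]
  refine h.trans (congrArg₂ _ ?_ ?_) <;>
    exact setIntegral_congr_fun measurableSet_Iic fun y hy => by simp only [e _ y hy]

end Primitive

/-! ### The distribution function of a finite measure -/

section Distribution

variable {μ : Measure ℝ}

/-- The distribution function `x ↦ μ (-∞, x]`. -/
noncomputable def distr (μ : Measure ℝ) (x : ℝ) : ℝ := μ.real (Set.Iic x)

theorem distr_nonneg (x : ℝ) : 0 ≤ distr μ x := measureReal_nonneg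

theorem prim_one (x : ℝ) : prim μ (fun _ => 1) x = distr μ x := by
  simp [prim, distr]

theorem distr_eq_re : distr μ = fun x => (prim μ (fun _ => 1) x).re :=
  funext fun x => by rw [prim_one, Complex.ofReal_re]

/-- The function `x ↦ exp (i z μ(-∞, x])`. -/
noncomputable def expDistr (μ : Measure ℝ) (z : ℂ) (x : ℝ) : ℂ :=
  Complex.exp (Complex.I * z * distr μ x)

theorem expDistr_ne_zero (z : ℂ) (x : ℝ) : expDistr μ z x ≠ 0 := Complex.exp_ne_zero _

variable [IsFiniteMeasure μ]

theorem distr_le (x : ℝ) : distr μ x ≤ μ.real Set.univ := measureReal_mono (Set.subset_univ _)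

theorem continuous_distr [NullSingletonClass μ] : Continuous (distr μ) := by
  rw [distr_eq_re]
  exact Complex.continuous_re.comp (continuous_prim (integrable_const _))

theorem tendsto_distr_atTop : Tendsto (distr μ) atTop (𝓝 (μ.real Set.univ)) := by
  rw [distr_eq_re]
  simpa [Function.comp_def] using (Complex.continuous_re.tendsto _).comp
    (tendsto_prim_atTop (integrable_const (μ := μ) (1 : ℂ)))

theorem tendsto_distr_atBot : Tendsto (distr μ) atBot (𝓝 0) := by
  rw [distr_eq_re]
  simpa [Function.comp_def] using (Complex.continuous_re.tendsto _).comp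
    (tendsto_prim_atBot (integrable_const (μ := μ) (1 : ℂ)))

theorem distr_strictMono [μ.IsOpenPosMeasure] : StrictMono (distr μ) := by
  intro a b hab
  have h : μ.real (Set.Iic b \ Set.Iic a) = distr μ b - distr μ a :=
    measureReal_sdiff (Set.Iic_subset_Iic.2 hab.le) measurableSet_Iic
  have h2 : 0 < μ (Set.Iic b \ Set.Iic a) := by
    rw [Set.Iic_sdiff_Iic]
    exact (Measure.measure_Ioo_pos μ |>.2 hab).trans_le (measure_mono Set.Ioo_subset_Ioc_self)
  have h3 : 0 < μ.real (Set.Iic b \ Set.Iic a) := ENNReal.toReal_pos h2.ne' (measure_ne_top _ _)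
  linarith

theorem distr_pos [μ.IsOpenPosMeasure] (x : ℝ) : 0 < distr μ x :=
  (distr_nonneg (x - 1)).trans_lt (distr_strictMono (by linarith))

/-- The distribution function pushes `μ` to the Lebesgue measure of an interval. -/
theorem map_distr [NullSingletonClass μ] [μ.IsOpenPosMeasure] :
    μ.map (distr μ) = volume.restrict (Set.Ioc 0 (μ.real Set.univ)) := by
  have hm : Measurable (distr μ) := continuous_distr.measurable
  refine Measure.ext_of_Iic _ _ fun a => ?_
  rw [Measure.map_apply hm measurableSet_Iic, Measure.restrict_apply measurableSet_Iic,
    Set.inter_comm, Set.Ioc_inter_Iic, Real.volume_Ioc, sub_zero]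
  rcases le_or_gt a 0 with ha | ha
  · have : distr μ ⁻¹' Set.Iic a = ∅ :=
      Set.eq_empty_of_forall_notMem fun x hx => (distr_pos x).not_ge (le_trans hx ha)
    rw [this, measure_empty, ENNReal.ofReal_of_nonpos]
    exact (min_le_right _ _).trans ha
  rcases le_or_gt (μ.real Set.univ) a with ha' | ha'
  · have : distr μ ⁻¹' Set.Iic a = Set.univ :=
      Set.eq_univ_of_forall fun x => (distr_le x).trans ha'
    rw [this, min_eq_left ha', ofReal_measureReal]
  -- For `a` strictly between `0` and the total mass, the intermediate value theorem gives `a = F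
  -- t`, and strict monotonicity turns the preimage into a half-line.
  · obtain ⟨t, ht⟩ : ∃ t, distr μ t = a := mem_range_of_exists_le_of_exists_ge continuous_distr
      ((tendsto_distr_atBot.eventually_lt_const ha).exists.imp fun _ h => h.le)
      ((tendsto_distr_atTop.eventually_const_lt ha').exists.imp fun _ h => h.le)
    have : distr μ ⁻¹' Set.Iic a = Set.Iic t := by
      ext x
      rw [Set.mem_preimage, Set.mem_Iic, ← ht, distr_strictMono.le_iff_le, Set.mem_Iic]
    rw [this, min_eq_right ha'.le, ← ht, distr, ofReal_measureReal]

theorem measureReal_distr_preimage_Ioc_le [NullSingletonClass μ] [μ.IsOpenPosMeasure] {a b : ℝ}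
    (hab : a ≤ b) : μ.real (distr μ ⁻¹' Set.Ioc a b) ≤ b - a := by
  have h : μ (distr μ ⁻¹' Set.Ioc a b) ≤ ENNReal.ofReal (b - a) := by
    rw [← Measure.map_apply continuous_distr.measurable measurableSet_Ioc, map_distr,
      ← Real.volume_Ioc]
    exact Measure.restrict_apply_le _ _
  exact ENNReal.toReal_le_of_le_ofReal (sub_nonneg.2 hab) h

theorem continuous_expDistr [NullSingletonClass μ] (z : ℂ) : Continuous (expDistr μ z) :=
  Complex.continuous_exp.comp
    (continuous_const.mul (Complex.continuous_ofReal.comp continuous_distr))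

theorem norm_expDistr_le (z : ℂ) (x : ℝ) :
    ‖expDistr μ z x‖ ≤ Real.exp (‖z‖ * μ.real Set.univ) := by
  refine (Complex.norm_exp_le_exp_norm _).trans (Real.exp_le_exp.2 ?_)
  rw [norm_mul, norm_mul, Complex.norm_I, one_mul, Complex.norm_real, Real.norm_eq_abs,
    abs_of_nonneg (distr_nonneg x)]
  exact mul_le_mul_of_nonneg_left (distr_le x) (norm_nonneg _)

theorem memLp_expDistr [NullSingletonClass μ] (z : ℂ) (p : ℝ≥0∞) : MemLp (expDistr μ z) p μ :=
  MemLp.of_bound (continuous_expDistr z).aestronglyMeasurable _ (ae_of_all _ (norm_expDistr_le z))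

theorem integrable_expDistr [NullSingletonClass μ] (z : ℂ) : Integrable (expDistr μ z) μ :=
  memLp_one_iff_integrable.1 (memLp_expDistr z 1)

theorem tendsto_expDistr_atTop (z : ℂ) : Tendsto (expDistr μ z) atTop
    (𝓝 (Complex.exp (Complex.I * z * μ.real Set.univ))) :=
  (Complex.continuous_exp.tendsto _).comp
    (((Complex.continuous_ofReal.tendsto _).comp tendsto_distr_atTop).const_mul _)

/-- `expDistr μ z` solves the integral equation `E = 1 + i z ∫ E dμ`. -/
theorem expDistr_eq [NullSingletonClass μ] [μ.IsOpenPosMeasure] (z : ℂ) (x : ℝ) :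
    expDistr μ z x = 1 + Complex.I * z * prim μ (expDistr μ z) x := by
  -- The substitution `s = F y`, allowed by `map_distr`, reduces the claim to an elementary integral
  -- of `exp (i z s)`.
  have h1 : prim μ (expDistr μ z) x
      = ∫ s in (0 : ℝ)..distr μ x, Complex.exp (Complex.I * z * s) := by
    rw [intervalIntegral.integral_of_le (distr_nonneg x)]
    have hset : Set.Iic x = distr μ ⁻¹' Set.Iic (distr μ x) := by
      ext y
      rw [Set.mem_preimage, Set.mem_Iic, Set.mem_Iic, distr_strictMono.le_iff_le]
    have hc : Continuous fun s : ℝ => Complex.exp (Complex.I * z * s) := by fun_prop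
    rw [prim, hset]
    refine (setIntegral_map (μ := μ) (g := distr μ) measurableSet_Iic
      (hc.aestronglyMeasurable) continuous_distr.aemeasurable).symm.trans ?_
    rw [map_distr, Measure.restrict_restrict measurableSet_Iic, Set.inter_comm,
      Set.Ioc_inter_Iic, min_eq_right (distr_le x)]
  rw [h1, ← intervalIntegral.integral_const_mul]
  have h2 : ∀ s ∈ Set.uIcc (0 : ℝ) (distr μ x),
      HasDerivAt (fun s : ℝ => Complex.exp (Complex.I * z * s))
        (Complex.I * z * Complex.exp (Complex.I * z * s)) s := by
    intro s _
    have := (((hasDerivAt_id (s : ℂ)).const_mul (Complex.I * z)).cexp).comp_ofReal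
    simpa [mul_comm] using this
  rw [intervalIntegral.integral_eq_sub_of_hasDerivAt h2
    (Continuous.intervalIntegrable (by fun_prop) _ _)]
  simp [expDistr]

theorem exp_eq_integral_expDistr [NullSingletonClass μ] [μ.IsOpenPosMeasure] (z : ℂ) :
    Complex.exp (Complex.I * z * μ.real Set.univ)
      = 1 + Complex.I * z * ∫ x, expDistr μ z x ∂μ := by
  refine tendsto_nhds_unique (tendsto_expDistr_atTop z) ?_
  refine Tendsto.congr (fun x => (expDistr_eq z x).symm) ?_
  exact ((tendsto_prim_atTop (integrable_expDistr z)).const_mul _).const_add _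

end Distribution

/-! ### The Volterra operator on `L²(μ)` -/

section Volterra

variable {μ : Measure ℝ} [IsFiniteMeasure μ]

theorem integrable_coeFn (g : Lp ℂ 2 μ) : Integrable g μ :=
  (Lp.memLp g).integrable (by norm_num)

/-- Cauchy–Schwarz against the indicator of `s`. -/
theorem norm_setIntegral_le (g : Lp ℂ 2 μ) {s : Set ℝ} (hs : MeasurableSet s) :
    ‖∫ x in s, g x ∂μ‖ ≤ √(μ.real s) * ‖g‖ := by
  rw [← L2.inner_indicatorConstLp_one hs (measure_ne_top μ s) g]
  refine (norm_inner_le_norm _ _).trans_eq ?_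
  rw [norm_indicatorConstLp (by norm_num) (by norm_num), Real.sqrt_eq_rpow]
  simp

theorem norm_prim_coeFn_le (g : Lp ℂ 2 μ) (x : ℝ) :
    ‖prim μ g x‖ ≤ √(μ.real Set.univ) * ‖g‖ :=
  (norm_setIntegral_le g measurableSet_Iic).trans
    (mul_le_mul_of_nonneg_right (Real.sqrt_le_sqrt (measureReal_mono (Set.subset_univ _)))
      (norm_nonneg _))

/-- The constant function `1` in `L²(μ)`. -/
noncomputable def oneL2 (μ : Measure ℝ) [IsFiniteMeasure μ] : Lp ℂ 2 μ := Lp.const 2 μ 1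

theorem coeFn_oneL2 : (oneL2 μ : ℝ → ℂ) =ᵐ[μ] fun _ => 1 := Lp.coeFn_const 2 μ 1

theorem inner_oneL2 (g : Lp ℂ 2 μ) : inner ℂ (oneL2 μ) g = ∫ x, g x ∂μ := by
  rw [oneL2, ← indicatorConstLp_univ, L2.inner_indicatorConstLp_one, setIntegral_univ]

variable [NullSingletonClass μ]

theorem memLp_prim {f : ℝ → ℂ} (hf : Integrable f μ) (p : ℝ≥0∞) : MemLp (prim μ f) p μ :=
  MemLp.of_bound (continuous_prim hf).aestronglyMeasurable _ (ae_of_all _ (norm_prim_le hf))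

/-- The Volterra operator `g ↦ ∫_{(-∞, x]} g dμ`. -/
noncomputable def volterra (μ : Measure ℝ) [IsFiniteMeasure μ] [NullSingletonClass μ] :
    Lp ℂ 2 μ →L[ℂ] Lp ℂ 2 μ :=
  LinearMap.mkContinuous
    { toFun := fun g => MemLp.toLp (prim μ g) (memLp_prim (integrable_coeFn g) 2)
      map_add' := fun f g => by
        rw [← MemLp.toLp_add]
        refine MemLp.toLp_congr _ _ (ae_of_all _ fun x => ?_)
        rw [prim_congr (Lp.coeFn_add f g)]
        exact prim_add (integrable_coeFn f) (integrable_coeFn g) x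
      map_smul' := fun c g => by
        rw [RingHom.id_apply, ← MemLp.toLp_const_smul]
        refine MemLp.toLp_congr _ _ (ae_of_all _ fun x => ?_)
        rw [prim_congr (Lp.coeFn_smul c g)]
        exact prim_const_mul c g x }
    ((measureUnivNNReal μ : ℝ) ^ ((2 : ℝ≥0∞).toReal⁻¹) * √(μ.real Set.univ)) fun g => by
      rw [mul_assoc]
      refine Lp.norm_le_of_ae_bound (by positivity) ?_
      filter_upwards [MemLp.coeFn_toLp (memLp_prim (integrable_coeFn g) 2)] with x hx
      exact (congrArg norm hx).trans_le (norm_prim_coeFn_le g x)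

theorem coeFn_volterra (g : Lp ℂ 2 μ) : (volterra μ g : ℝ → ℂ) =ᵐ[μ] prim μ g :=
  MemLp.coeFn_toLp (memLp_prim (integrable_coeFn g) 2)

/-- The adjoint of the Volterra operator is integration over the complementary half-line. -/
theorem inner_volterra_add (f g : Lp ℂ 2 μ) :
    inner ℂ f (volterra μ g) + inner ℂ (volterra μ f) g
      = inner ℂ f (oneL2 μ) * inner ℂ (oneL2 μ) g := by
  have hf : Integrable (fun x => starRingEnd ℂ (f x)) μ :=
    (integrable_coeFn f).congr' (Complex.continuous_conj.comp_aestronglyMeasurable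
      (integrable_coeFn f).aestronglyMeasurable) (ae_of_all _ fun x => by simp)
  -- Fubini for `conj f` and `g`: the two terms are the two triangles on either side of the
  -- diagonal.
  have h := integral_mul_integral hf (integrable_coeFn g)
  have e1 : inner ℂ f (volterra μ g) = ∫ x, starRingEnd ℂ (f x) * prim μ g x ∂μ := by
    rw [L2.inner_def]
    refine integral_congr_ae ?_
    filter_upwards [coeFn_volterra g] with x hx
    rw [hx, RCLike.inner_apply, mul_comm]
  have e2 : inner ℂ (volterra μ f) g
      = ∫ x, g x * prim μ (fun x => starRingEnd ℂ (f x)) x ∂μ := by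
    rw [L2.inner_def]
    refine integral_congr_ae ?_
    filter_upwards [coeFn_volterra f] with x hx
    rw [hx, RCLike.inner_apply, prim, prim, integral_conj]
  rw [e1, e2, ← h, ← inner_conj_symm f, inner_oneL2, inner_oneL2, ← integral_conj]

/-- `expDistr μ z` as an element of `L²(μ)`. -/
noncomputable def expL2 (μ : Measure ℝ) [IsFiniteMeasure μ] [NullSingletonClass μ] (z : ℂ) :
    Lp ℂ 2 μ :=
  MemLp.toLp (expDistr μ z) (memLp_expDistr z 2)

theorem coeFn_expL2 (z : ℂ) : (expL2 μ z : ℝ → ℂ) =ᵐ[μ] expDistr μ z :=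
  MemLp.coeFn_toLp (memLp_expDistr z 2)

variable [μ.IsOpenPosMeasure]

/-- The Volterra operator is approximated by operators of finite rank. -/
theorem exists_finiteRank_approx {ε : ℝ} (hε : 0 < ε) :
    ∃ T : Lp ℂ 2 μ →L[ℂ] Lp ℂ 2 μ, IsCompactOperator T ∧ ‖volterra μ - T‖ ≤
      (measureUnivNNReal μ : ℝ) ^ ((2 : ℝ≥0∞).toReal⁻¹) * √ε := by
  have hmeas : Measurable (distr μ) := continuous_distr.measurable
  -- The values of `F` are cut into cells of length `ε`. For `x` in cell `j`, the half-line `(-∞,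
  -- x]` is replaced by `S j`, so the kernel becomes a finite sum of products of indicators.
  let S : ℕ → Set ℝ := fun j => distr μ ⁻¹' Set.Iic (j * ε)
  let idx : ℝ → ℕ := fun x => ⌊distr μ x / ε⌋₊
  have hidx : Measurable idx := Nat.measurable_floor.comp (hmeas.div_const ε)
  have hS : ∀ j, MeasurableSet (S j) := fun j => hmeas measurableSet_Iic
  have hT : ∀ j, MeasurableSet (idx ⁻¹' {j}) := fun j => hidx (measurableSet_singleton j)
  let N : ℕ := ⌊μ.real Set.univ / ε⌋₊ + 1
  let T : Lp ℂ 2 μ →L[ℂ] Lp ℂ 2 μ := ∑ j ∈ Finset.range N,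
    (innerSL ℂ (indicatorConstLp 2 (hS j) (measure_ne_top μ _) (1 : ℂ))).smulRight
      (indicatorConstLp 2 (hT j) (measure_ne_top μ _) (1 : ℂ))
  have hidxN : ∀ x, idx x ∈ Finset.range N := fun x => Finset.mem_range.2 <| Nat.lt_succ_of_le <|
    Nat.floor_mono (div_le_div_of_nonneg_right (distr_le x) hε.le)
  have hTg : ∀ g : Lp ℂ 2 μ, (T g : ℝ → ℂ) =ᵐ[μ] fun x => ∫ y in S (idx x), g y ∂μ := by
    intro g
    have e : T g = ∑ j ∈ Finset.range N, (∫ y in S j, g y ∂μ) •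
        indicatorConstLp 2 (hT j) (measure_ne_top μ _) (1 : ℂ) := by
      simp only [T, sum_apply, ContinuousLinearMap.smulRight_apply,
        innerSL_apply_apply, L2.inner_indicatorConstLp_one]
    rw [e]
    refine (Lp.coeFn_fun_finsetSum _ _).trans ?_
    have h1 : ∀ᵐ x ∂μ, ∀ j ∈ Finset.range N, ((∫ y in S j, g y ∂μ) •
        indicatorConstLp 2 (hT j) (measure_ne_top μ _) (1 : ℂ) : Lp ℂ 2 μ) x
        = (∫ y in S j, g y ∂μ) * (idx ⁻¹' {j}).indicator (fun _ => (1 : ℂ)) x := by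
      refine (Finset.eventually_all _).2 fun j _ => ?_
      filter_upwards [Lp.coeFn_smul (∫ y in S j, g y ∂μ)
        (indicatorConstLp 2 (hT j) (measure_ne_top μ _) (1 : ℂ)),
        indicatorConstLp_coeFn (p := 2) (hs := hT j) (hμs := measure_ne_top μ _)
          (c := (1 : ℂ))] with x h2 h3
      rw [h2, Pi.smul_apply, h3, smul_eq_mul]
    filter_upwards [h1] with x hx
    rw [Finset.sum_congr rfl hx, Finset.sum_eq_single_of_mem (idx x) (hidxN x)]
    · simp
    · intro j _ hj
      simp [Set.indicator, hj.symm]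
  refine ⟨T, ?_, ContinuousLinearMap.opNorm_le_bound _ (by positivity) fun g => ?_⟩
  · refine (compactOperator (RingHom.id ℂ) (Lp ℂ 2 μ) (Lp ℂ 2 μ)).sum_mem fun j _ => ?_
    exact (isCompactOperator_of_locallyCompactSpace_dom
      (innerSL ℂ (indicatorConstLp 2 (hS j) (measure_ne_top μ _) (1 : ℂ)))).clm_comp
        (ContinuousLinearMap.toSpanSingleton ℂ
          (indicatorConstLp 2 (hT j) (measure_ne_top μ _) (1 : ℂ)))
  · rw [mul_assoc]
    refine Lp.norm_le_of_ae_bound (by positivity) ?_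
    filter_upwards [Lp.coeFn_sub (volterra μ g) (T g), coeFn_volterra g, hTg g] with x h1 h2 h3
    rw [sub_apply, h1, Pi.sub_apply, h2, h3]
    have hle : idx x * ε ≤ distr μ x :=
      (le_div_iff₀ hε).1 (Nat.floor_le (div_nonneg (distr_nonneg x) hε.le))
    have hlt : distr μ x < (idx x + 1) * ε := (div_lt_iff₀ hε).1 (Nat.lt_floor_add_one _)
    have hsub : S (idx x) ⊆ Set.Iic x := fun y hy =>
      distr_strictMono.le_iff_le.1 (le_trans hy hle)
    -- The discarded part of the half-line is the preimage under `F` of an interval of length at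
    -- most `ε`. Since `F` pushes `μ` to Lebesgue measure, it has mass at most `ε`, and the
    -- pointwise error is at most `√ε ‖g‖`.
    have hd : Set.Iic x \ S (idx x) = distr μ ⁻¹' Set.Ioc (idx x * ε) (distr μ x) := by
      ext y
      simp [S, distr_strictMono.le_iff_le, and_comm]
    have hint : prim μ g x - ∫ y in S (idx x), g y ∂μ = ∫ y in Set.Iic x \ S (idx x), g y ∂μ :=
      (setIntegral_sdiff (hS _) (integrable_coeFn g).integrableOn hsub).symm
    rw [hint]
    refine (norm_setIntegral_le g (measurableSet_Iic.diff (hS _))).trans ?_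
    refine mul_le_mul_of_nonneg_right (Real.sqrt_le_sqrt ?_) (norm_nonneg _)
    rw [hd]
    exact (measureReal_distr_preimage_Ioc_le hle).trans (by linarith)

theorem isCompactOperator_volterra : IsCompactOperator (volterra μ) := by
  choose T hT hT' using fun n : ℕ =>
    exists_finiteRank_approx (μ := μ) (ε := 1 / ((n : ℝ) + 1)) (by positivity)
  refine isCompactOperator_of_tendsto (l := atTop) (F := T) ?_ (Eventually.of_forall hT)
  rw [tendsto_iff_norm_sub_tendsto_zero]
  refine squeeze_zero (fun _ => norm_nonneg _)
    (fun n => (norm_sub_rev _ _).trans_le (hT' n)) ?_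
  have h := (Real.continuous_sqrt.tendsto 0).comp
    (tendsto_one_div_add_atTop_nhds_zero_nat (𝕜 := ℝ))
  simpa using h.const_mul ((measureUnivNNReal μ : ℝ) ^ ((2 : ℝ≥0∞).toReal⁻¹))

/-- Homogeneous Volterra equations have only the trivial solution. -/
theorem prim_eq_zero_of_eq {h : ℝ → ℂ} (hh : Integrable h μ) {z : ℂ}
    (e : h =ᵐ[μ] fun x => Complex.I * z * prim μ h x) : prim μ h = 0 := by
  funext x
  have hF := integrable_expDistr (μ := μ) (-z)
  -- Integrating factor: `E_{-z} = 1 - i z ∫ E_{-z} dμ`, so by the product rule the two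
  -- contributions to `E_{-z} · prim μ h` cancel, and `E_{-z}` has no zero.
  have h1 := prim_mul_prim hF hh x
  have h2 : prim μ (fun y => h y * prim μ (expDistr μ (-z)) y) x * (Complex.I * z)
      = prim μ h x - prim μ (fun y => h y * expDistr μ (-z) y) x := by
    have hi : Integrable (fun y => h y * expDistr μ (-z) y) μ :=
      hh.mul_bdd hF.aestronglyMeasurable (ae_of_all _ (norm_expDistr_le _))
    rw [← prim_sub hh hi, mul_comm, ← prim_const_mul]
    congr 1
    funext y
    rw [expDistr_eq (-z) y]
    ring
  have h3 : prim μ (fun y => h y * expDistr μ (-z) y) x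
      = Complex.I * z * prim μ (fun y => expDistr μ (-z) y * prim μ h y) x := by
    rw [← prim_const_mul]
    refine congrFun (prim_congr ?_) x
    filter_upwards [e] with y hy
    rw [hy]
    ring
  have h4 : expDistr μ (-z) x * prim μ h x = 0 := by
    rw [expDistr_eq]
    linear_combination (-(Complex.I * z)) * h1 - h2 + h3
  exact (mul_eq_zero.1 h4).resolve_left (expDistr_ne_zero _ _)

theorem eq_zero_of_eq_smul_volterra {z : ℂ} {h : Lp ℂ 2 μ}
    (e : h = (Complex.I * z) • volterra μ h) : h = 0 := by
  have h1 : (h : ℝ → ℂ) =ᵐ[μ] fun x => Complex.I * z * prim μ h x := by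
    have h2 := Lp.coeFn_smul (Complex.I * z) (volterra μ h)
    rw [← e] at h2
    filter_upwards [h2, coeFn_volterra h] with x h3 h4
    rw [h3, Pi.smul_apply, h4, smul_eq_mul]
  have h5 := prim_eq_zero_of_eq (integrable_coeFn h) h1
  refine (Lp.eq_zero_iff_ae_eq_zero).2 ?_
  filter_upwards [h1] with x hx
  rw [hx, h5, Pi.zero_apply, mul_zero]

/-- `1 - i z V` is invertible, for the Volterra operator `V`. -/
theorem exists_equiv_one_sub_volterra (z : ℂ) : ∃ B : Lp ℂ 2 μ ≃L[ℂ] Lp ℂ 2 μ,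
    ∀ h, B h = h - (Complex.I * z) • volterra μ h := by
  rcases eq_or_ne z 0 with rfl | hz
  · exact ⟨.refl ℂ _, fun h => by simp⟩
  have hz' : (Complex.I * z)⁻¹ ≠ 0 := inv_ne_zero (mul_ne_zero Complex.I_ne_zero hz)
  -- Fredholm alternative at `(i z)⁻¹`: an eigenvector would solve the homogeneous equation `h = i z
  -- V h`.
  rcases isCompactOperator_volterra.hasEigenvalue_or_mem_resolventSet (T := volterra μ) hz'
    with h | h
  · obtain ⟨v, hv⟩ := h.exists_hasEigenvector
    refine absurd (eq_zero_of_eq_smul_volterra (z := z) ?_) hv.2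
    have := hv.apply_eq_smul
    rw [ContinuousLinearMap.coe_coe] at this
    rw [this, smul_smul, mul_inv_cancel₀ (mul_ne_zero Complex.I_ne_zero hz), one_smul]
  · rw [spectrum.mem_resolventSet_iff] at h
    obtain ⟨u, hu⟩ := h
    have hzz := mul_ne_zero Complex.I_ne_zero hz
    let k : (Lp ℂ 2 μ →L[ℂ] Lp ℂ 2 μ)ˣ := Units.mk0 (Complex.I * z) hzz • u
    refine ⟨ContinuousLinearEquiv.ofUnit k, fun h => ?_⟩
    change (Complex.I * z) • (u : Lp ℂ 2 μ →L[ℂ] Lp ℂ 2 μ) h = _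
    rw [hu, sub_apply, smul_sub, Algebra.algebraMap_eq_smul_one,
      smul_apply, one_apply_eq_self, smul_smul,
      mul_inv_cancel₀ hzz, one_smul]

theorem expL2_eq (z : ℂ) :
    expL2 μ z = oneL2 μ + (Complex.I * z) • volterra μ (expL2 μ z) := by
  refine Lp.ext ?_
  filter_upwards [coeFn_expL2 (μ := μ) z, coeFn_oneL2 (μ := μ), coeFn_volterra (expL2 μ z),
    Lp.coeFn_add (oneL2 μ) ((Complex.I * z) • volterra μ (expL2 μ z)),
    Lp.coeFn_smul (Complex.I * z) (volterra μ (expL2 μ z))] with x h1 h2 h3 h4 h5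
  rw [h1, h4, Pi.add_apply, h2, h5, Pi.smul_apply, h3, prim_congr (coeFn_expL2 z), expDistr_eq,
    smul_eq_mul]

theorem exp_eq_inner_expL2 (z : ℂ) : Complex.exp (Complex.I * z * μ.real Set.univ)
    = 1 + Complex.I * z * inner ℂ (oneL2 μ) (expL2 μ z) := by
  rw [exp_eq_integral_expDistr, inner_oneL2, integral_congr_ae (coeFn_expL2 z)]

/-- If it vanished, `expL2_eq` would give `1 = 0` almost everywhere for a nonzero measure. -/
theorem expL2_ne_zero (z : ℂ) : expL2 μ z ≠ 0 := by
  intro h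
  have h1 := expL2_eq (μ := μ) z
  rw [h, map_zero, smul_zero, add_zero] at h1
  have h2 := coeFn_oneL2 (μ := μ)
  rw [← h1] at h2
  have : ∀ᵐ x ∂μ, False := by
    filter_upwards [h2, Lp.coeFn_zero ℂ 2 μ] with x h3 h4
    rw [h4] at h3
    exact zero_ne_one h3
  rw [Filter.eventually_false_iff_eq_bot, ae_eq_bot] at this
  exact (Measure.measure_univ_ne_zero.1 (isOpen_univ.measure_pos μ Set.univ_nonempty).ne') this

theorem oneL2_ne_zero : oneL2 μ ≠ 0 := by
  have h := expL2_ne_zero (μ := μ) 0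
  rwa [expL2_eq, mul_zero, zero_smul, add_zero] at h

end Volterra

/-! ### Weak derivatives and primitives -/

section WeakDerivative

theorem HasWeakDeriv.congr_deriv {f f₁ f₂ : ℝ → ℂ} (h : HasWeakDeriv f f₁)
    (e : f₁ =ᵐ[volume] f₂) : HasWeakDeriv f f₂ := by
  refine ⟨h.1, h.2.1.congr e, fun φ hφ hc => ?_⟩
  rw [h.2.2 φ hφ hc]
  congr 1
  refine integral_congr_ae ?_
  filter_upwards [e] with x hx
  rw [hx]

theorem integral_deriv_eq_zero {φ : ℝ → ℝ} (hφ : ContDiff ℝ ∞ φ) (hc : HasCompactSupport φ) :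
    ∫ x, deriv φ x = 0 :=
  integral_of_hasDerivAt_of_tendsto (fun x => (hφ.differentiable (by simp) x).hasDerivAt)
    ((hφ.continuous_deriv (by simp)).integrable_of_hasCompactSupport hc.deriv)
    (hc.is_zero_at_infty.mono_left atBot_le_cocompact)
    (hc.is_zero_at_infty.mono_left atTop_le_cocompact) |>.trans (sub_zero 0)

/-- A primitive of an integrable function has this function as its weak derivative. -/
theorem hasWeakDeriv_const_add_prim {h : ℝ → ℂ} (hh : Integrable h) (c : ℂ) :
    HasWeakDeriv (fun x => c + prim volume h x) h := by
  have hcont : Continuous (prim volume h) := continuous_prim hh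
  refine ⟨(continuous_const.add hcont).locallyIntegrable, hh.locallyIntegrable,
    fun φ hφ hc => ?_⟩
  have hd : Continuous (deriv φ) := hφ.continuous_deriv (by simp)
  have hdi : Integrable (deriv φ) := hd.integrable_of_hasCompactSupport hc.deriv
  have hdc : Integrable fun x => ((deriv φ x : ℝ) : ℂ) := hdi.ofReal
  have h0 : ∫ x, ((deriv φ x : ℝ) : ℂ) = 0 := by
    rw [integral_complex_ofReal, integral_deriv_eq_zero hφ hc, Complex.ofReal_zero]
  have hp : ∀ x, prim volume (fun y => ((deriv φ y : ℝ) : ℂ)) x = φ x := fun x => by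
    rw [prim, integral_complex_ofReal, hc.integral_Iic_deriv_eq (hφ.of_le (by simp)) x]
  -- Integration by parts for `φ'` and `h`: the primitive of `φ'` is `φ`, and the total integral of
  -- `φ'` is `0`.
  have key := integral_mul_integral hdc hh
  rw [h0, zero_mul] at key
  simp only [hp] at key
  have e1 : ∫ x, deriv φ x • (c + prim volume h x)
      = (∫ x, ((deriv φ x : ℝ) : ℂ) * c) + ∫ x, ((deriv φ x : ℝ) : ℂ) * prim volume h x := by
    rw [← integral_add (hdc.mul_const c) (Integrable.mul_prim hdc hh)]
    refine integral_congr_ae (ae_of_all _ fun x => ?_)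
    simp only [Complex.real_smul, mul_add]
  have e2 : ∫ x, φ x • h x = ∫ x, h x * φ x :=
    integral_congr_ae (ae_of_all _ fun x => by simp [mul_comm])
  rw [e1, e2, integral_mul_const, h0, zero_mul, zero_add]
  exact eq_neg_of_add_eq_zero_left key.symm

/-- A smooth compactly supported function with integral `0` is the derivative of such a
function. -/
theorem exists_deriv_eq {φ : ℝ → ℝ} (hφ : ContDiff ℝ ∞ φ) (hc : HasCompactSupport φ)
    (h0 : ∫ x, φ x = 0) :
    ∃ Φ : ℝ → ℝ, ContDiff ℝ ∞ Φ ∧ HasCompactSupport Φ ∧ deriv Φ = φ := by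
  have hi : Integrable φ := hφ.continuous.integrable_of_hasCompactSupport hc
  obtain ⟨R, hR⟩ := hc.isCompact.isBounded.subset_closedBall 0
  rw [Real.closedBall_eq_Icc, zero_sub, zero_add] at hR
  have hz : ∀ x, x ∉ Set.Icc (-R) R → φ x = 0 := fun x hx =>
    image_eq_zero_of_notMem_tsupport fun h => hx (hR h)
  have hd : ∀ x, HasDerivAt (fun x => ∫ y in (-R)..x, φ y) (φ x) x := fun x =>
    intervalIntegral.integral_hasDerivAt_right (hφ.continuous.intervalIntegrable _ _)
      (hφ.continuous.stronglyMeasurableAtFilter _ _) hφ.continuous.continuousAt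
  have hde : deriv (fun x => ∫ y in (-R)..x, φ y) = φ := funext fun x => (hd x).deriv
  refine ⟨fun x => ∫ y in (-R)..x, φ y, ?_, ?_, hde⟩
  · exact contDiff_infty_iff_deriv.2 ⟨fun x => (hd x).differentiableAt, hde.symm ▸ hφ⟩
  · have hneg : ∀ x, x ≤ -R → ∫ y in Set.Iic x, φ y = 0 := fun x hx => by
      rw [setIntegral_congr_set Iio_ae_eq_Iic.symm]
      refine setIntegral_eq_zero_of_forall_eq_zero fun y hy => hz y fun h => ?_
      exact absurd (h.1.trans_lt hy) hx.not_gt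
    refine HasCompactSupport.intro (isCompact_Icc (a := -R) (b := R)) fun x hx => ?_
    rw [← intervalIntegral.integral_Iic_sub_Iic hi.integrableOn hi.integrableOn, hneg _ le_rfl,
      sub_zero]
    rcases lt_or_ge x (-R) with h | h
    · exact hneg x h.le
    -- To the right of `R` the primitive equals the total integral, which is `0`.
    · have hx' : R < x := not_le.1 fun h' => hx ⟨h, h'⟩
      have h1 : ∫ y in Set.Ioi x, φ y = 0 :=
        setIntegral_eq_zero_of_forall_eq_zero fun y hy =>
          hz y fun h' => absurd (hx'.trans hy) h'.2.not_gt
      have h2 := integral_add_compl (measurableSet_Iic (a := x)) hi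
      rwa [Set.compl_Iic, h1, h0, add_zero] at h2

/-- A function with weak derivative `0` is constant. -/
theorem HasWeakDeriv.ae_eq_const {f : ℝ → ℂ} (h : HasWeakDeriv f 0) :
    ∃ c : ℂ, f =ᵐ[volume] fun _ => c := by
  let b : ContDiffBump (0 : ℝ) := default
  let ψ : ℝ → ℝ := b.normed volume
  have hψ : ContDiff ℝ ∞ ψ := b.contDiff_normed
  have hψc : HasCompactSupport ψ := b.hasCompactSupport_normed
  have hψ1 : ∫ x, ψ x = 1 := b.integral_normed
  refine ⟨∫ x, ψ x • f x, ae_eq_of_integral_contDiff_smul_eq h.1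
    continuous_const.locallyIntegrable fun φ hφ hc => ?_⟩
  have hφi : Integrable φ := hφ.continuous.integrable_of_hasCompactSupport hc
  have hψi : Integrable ψ := hψ.continuous.integrable_of_hasCompactSupport hψc
  -- Subtracting `a ψ` gives mean zero, hence a derivative of a test function, which `f`
  -- annihilates. So `∫ φ f = (∫ φ) (∫ ψ f)`.
  let a : ℝ := ∫ x, φ x
  have h0 : ∫ x, (φ x - a * ψ x) = 0 := by
    rw [integral_sub hφi (hψi.const_mul a), integral_const_mul, hψ1, mul_one, sub_self]
  have hsm : ContDiff ℝ ∞ fun x => φ x - a * ψ x := hφ.sub (contDiff_const.mul hψ)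
  have hcs : HasCompactSupport fun x => φ x - a * ψ x := hc.sub hψc.mul_left
  obtain ⟨Φ, hΦ, hΦc, hΦd⟩ := exists_deriv_eq hsm hcs h0
  have h1 := h.2.2 Φ hΦ hΦc
  rw [hΦd] at h1
  simp only [Pi.zero_apply, smul_zero, integral_zero, neg_zero, sub_smul, mul_smul] at h1
  have h2 : Integrable fun x => a • ψ x • f x :=
    (h.1.integrable_smul_left_of_hasCompactSupport hψ.continuous hψc).smul a
  rw [integral_sub (h.1.integrable_smul_left_of_hasCompactSupport hφ.continuous hc) h2,
    integral_smul, sub_eq_zero] at h1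
  rw [h1, integral_smul_const]

/-- A function with integrable weak derivative is a primitive. -/
theorem HasWeakDeriv.ae_eq_const_add_prim {f h : ℝ → ℂ} (hf : HasWeakDeriv f h)
    (hh : Integrable h) : ∃ c : ℂ, f =ᵐ[volume] fun x => c + prim volume h x := by
  have h1 := (hf.add ((hasWeakDeriv_const_add_prim hh 0).const_smul (-1))).congr_deriv
    (f₂ := 0) (ae_of_all _ fun x => by simp)
  obtain ⟨c, hc⟩ := h1.ae_eq_const
  refine ⟨c, ?_⟩
  filter_upwards [hc] with x hx
  rw [← hx]
  simp

end WeakDerivative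

/-! ### The domains in terms of the Volterra operator -/

section Domains

variable {w : ℝ → ℝ}

theorem IsWeight.isFiniteMeasure (hw : IsWeight w) : IsFiniteMeasure (weightedMeasure w) :=
  isFiniteMeasure_withDensity_ofReal hw.integrable.2

/-- Positivity of `w` almost everywhere makes Lebesgue measure absolutely continuous with respect to
`w dx`. This is what makes `distr` strictly increasing. -/
theorem IsWeight.isOpenPosMeasure (hw : IsWeight w) : (weightedMeasure w).IsOpenPosMeasure := by
  have h : volume ≪ weightedMeasure w := by
    refine Measure.AbsolutelyContinuous.mk fun s _ hs => ?_
    rw [← compl_compl s] at hs ⊢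
    exact hw.ae_iff hs
  exact h.isOpenPosMeasure

instance : NullSingletonClass (weightedMeasure w) :=
  nullSingletonClass_withDensity fun x => ENNReal.ofReal (w x)

theorem IsWeight.integrable_iff (hw : IsWeight w) {f : ℝ → ℂ} :
    Integrable f (weightedMeasure w) ↔ Integrable fun x => (w x : ℂ) * f x := by
  rw [weightedMeasure, integrable_withDensity_iff_integrable_smul₀' hw.aemeasurable (by simp)]
  refine integrable_congr ?_
  filter_upwards [hw.pos] with x hx
  rw [ENNReal.toReal_ofReal hx.le, Complex.real_smul]

theorem IsWeight.prim_eq (hw : IsWeight w) (f : ℝ → ℂ) :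
    prim (weightedMeasure w) f = prim volume fun x => (w x : ℂ) * f x := by
  funext x
  refine (setIntegral_withDensity_eq_setIntegral_toReal_smul₀ hw.aemeasurable.restrict (by simp) f
    measurableSet_Iic).trans (integral_congr_ae (ae_restrict_of_ae ?_))
  filter_upwards [hw.pos] with x hx
  rw [ENNReal.toReal_ofReal hx.le, Complex.real_smul]

theorem IsWeight.measureReal_univ (hw : IsWeight w) :
    (weightedMeasure w).real Set.univ = ∫ x, |w x| := by
  rw [measureReal_def, weightedMeasure, withDensity_apply _ MeasurableSet.univ,
    setLIntegral_univ, ← integral_toReal hw.aemeasurable (by simp)]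
  refine integral_congr_ae ?_
  filter_upwards [hw.pos] with x hx
  rw [ENNReal.toReal_ofReal hx.le, abs_of_pos hx]

theorem IsWeight.maxOp_ae (hw : IsWeight w) (u : (maxOp hw).domain) :
    (maxOp hw u : ℝ → ℂ) =ᵐ[volume] weightedMomentum w (u : L2w w) :=
  hw.ae_iff (MemLp.coeFn_toLp u.2.2)

theorem IsWeight.memLp_sqrt_mul (hw : IsWeight w) (g : L2w w) :
    MemLp (fun x => (√(w x) : ℂ) * g x) 2 := by
  have hg : AEStronglyMeasurable g volume := by
    refine (Lp.stronglyMeasurable g).aestronglyMeasurable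
  have hm : AEStronglyMeasurable (fun x => (√(w x) : ℂ) * g x) volume :=
    (Complex.continuous_ofReal.comp_aestronglyMeasurable
      (Real.continuous_sqrt.comp_aestronglyMeasurable hw.integrable.1)).mul hg
  rw [memLp_two_iff_integrable_sq_norm hm]
  have h1 : Integrable (fun x => ‖g x‖ ^ 2)
      (volume.withDensity fun x => ENNReal.ofReal (w x)) :=
    (memLp_two_iff_integrable_sq_norm (Lp.memLp g).1).1 (Lp.memLp g)
  rw [integrable_withDensity_iff_integrable_smul₀' hw.aemeasurable
    (by simp)] at h1
  refine h1.congr ?_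
  filter_upwards [hw.pos] with x hx
  rw [norm_mul, mul_pow, Complex.norm_real, Real.norm_eq_abs, sq_abs, Real.sq_sqrt hx.le,
    ENNReal.toReal_ofReal hx.le, smul_eq_mul]

variable [IsFiniteMeasure (weightedMeasure w)]

/-- The continuous representative of `c + i V g`. -/
theorem IsWeight.coeFn_const_add_volterra (hw : IsWeight w) (c : ℂ) (g : L2w w) :
    ((c • oneL2 (weightedMeasure w) + Complex.I • volterra (weightedMeasure w) g : L2w w) : ℝ → ℂ)
      =ᵐ[volume] fun x => c + Complex.I * prim (weightedMeasure w) g x := by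
  filter_upwards [hw.coeFn_add (c • oneL2 (weightedMeasure w))
    (Complex.I • volterra (weightedMeasure w) g), hw.coeFn_smul c (oneL2 (weightedMeasure w)),
    hw.coeFn_smul Complex.I (volterra (weightedMeasure w) g), hw.ae_iff coeFn_oneL2,
    hw.ae_iff (coeFn_volterra g)] with x h1 h2 h3 h4 h5
  rw [h1, Pi.add_apply, h2, h3, Pi.smul_apply, Pi.smul_apply, h4, h5, smul_eq_mul, smul_eq_mul,
    mul_one]

theorem IsWeight.hasWeakDeriv_const_add_volterra (hw : IsWeight w) (c : ℂ) (g : L2w w) :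
    HasWeakDeriv (c • oneL2 (weightedMeasure w) + Complex.I • volterra (weightedMeasure w) g :
      L2w w) fun x => Complex.I * (w x * g x) := by
  have hi : Integrable fun x => (w x : ℂ) * g x := hw.integrable_iff.1 (integrable_coeFn g)
  refine (hasWeakDeriv_const_add_prim (hi.const_mul Complex.I) c).congr ?_
  filter_upwards [hw.coeFn_const_add_volterra c g] with x hx
  rw [hx, hw.prim_eq, prim_const_mul]

theorem IsWeight.weightedMomentum_const_add_volterra (hw : IsWeight w) (c : ℂ) (g : L2w w) :
    weightedMomentum w (c • oneL2 (weightedMeasure w) +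
      Complex.I • volterra (weightedMeasure w) g : L2w w) =ᵐ[volume] g := by
  filter_upwards [(hw.hasWeakDeriv_const_add_volterra c g).weakDeriv_ae, hw.pos] with x hx hp
  have hne : (w x : ℂ) ≠ 0 := Complex.ofReal_ne_zero.2 hp.ne'
  rw [weightedMomentum, momentum, hx, Complex.ofReal_inv]
  field_simp
  rw [Complex.I_sq]
  ring

/-- The graph of the maximal operator. -/
theorem IsWeight.mem_graph_maxOp (hw : IsWeight w) {u g : L2w w} :
    (u, g) ∈ (maxOp hw).graph ↔ ∃ c : ℂ,
      u = c • oneL2 (weightedMeasure w) + Complex.I • volterra (weightedMeasure w) g := by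
  rw [LinearPMap.mem_graph_iff]
  constructor
  · rintro ⟨y, rfl, rfl⟩
    have hwd := y.2.1.hasWeakDeriv
    -- Solving `w⁻¹ (-i u') = g` for `u'`. The right side is Lebesgue integrable because `L²(μ) ⊆
    -- L¹(μ)`, so `u` is a constant plus a primitive.
    have e : weakDeriv (y : L2w w) =ᵐ[volume] fun x => Complex.I * (w x * maxOp hw y x) := by
      filter_upwards [hw.maxOp_ae y, hw.pos] with x hx hp
      have hne : (w x : ℂ) ≠ 0 := Complex.ofReal_ne_zero.2 hp.ne'
      rw [hx, weightedMomentum, momentum, Complex.ofReal_inv, mul_inv_cancel_left₀ hne,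
        ← mul_assoc, mul_neg, Complex.I_mul_I, neg_neg, one_mul]
    have hi : Integrable fun x => (w x : ℂ) * maxOp hw y x :=
      hw.integrable_iff.1 (integrable_coeFn _)
    obtain ⟨c, hc⟩ := (hwd.congr_deriv e).ae_eq_const_add_prim (hi.const_mul Complex.I)
    refine ⟨c, Lp.ext (weightedMeasure_ac.ae_le ?_)⟩
    filter_upwards [hc, hw.coeFn_const_add_volterra c (maxOp hw y)] with x h1 h2
    rw [h2, h1, prim_const_mul, ← hw.prim_eq]
  · rintro ⟨c, rfl⟩
    have e := (weightedMeasure_ac (w := w)).ae_le (hw.weightedMomentum_const_add_volterra c g)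
    have hm := (memLp_congr_ae e).2 (Lp.memLp g)
    exact ⟨⟨_, ⟨_, hw.hasWeakDeriv_const_add_volterra c g⟩, hm⟩, rfl,
      Lp.ext (hm.coeFn_toLp.trans e)⟩

/-- The continuous representative is unique and tends to `c` at `-∞` and to `c + i ⟪1, g⟫` at `∞`.
-/
theorem IsWeight.twistedLimits_iff (hw : IsWeight w) {α c : ℂ} {g : L2w w} :
    TwistedLimits α (c • oneL2 (weightedMeasure w) +
      Complex.I • volterra (weightedMeasure w) g : L2w w) ↔
      (α - 1) * c = Complex.I * inner ℂ (oneL2 (weightedMeasure w)) g := by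
  have hcont : Continuous fun x => c + Complex.I * prim (weightedMeasure w) g x :=
    continuous_const.add (continuous_const.mul (continuous_prim (integrable_coeFn g)))
  have hbot : Tendsto (fun x => c + Complex.I * prim (weightedMeasure w) g x) atBot (𝓝 c) := by
    simpa using ((tendsto_prim_atBot (integrable_coeFn g)).const_mul Complex.I).const_add c
  have htop := ((tendsto_prim_atTop (integrable_coeFn g)).const_mul Complex.I).const_add c
  rw [inner_oneL2]
  have hae := hw.coeFn_const_add_volterra c g
  constructor
  · rintro ⟨k, hk, ek, l, hl, hl'⟩
    have e := (hcont.ae_eq_iff_eq volume hk).1 (hae.symm.trans ek)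
    rw [← e] at hl hl'
    have h1 := tendsto_nhds_unique hl hbot
    have h2 := tendsto_nhds_unique hl' htop
    rw [h1] at h2
    linear_combination h2
  · intro h
    refine ⟨_, hcont, hae, c, hbot, ?_⟩
    rwa [show α * c = c + Complex.I * ∫ x, g x ∂(weightedMeasure w) by linear_combination h]

/-- The graph of `T_w^α`. -/
theorem IsWeight.mem_graph_TwTwisted (hw : IsWeight w) {α : ℂ} {u g : L2w w} :
    (u, g) ∈ (TwTwisted hw α).graph ↔ ∃ c : ℂ,
      u = c • oneL2 (weightedMeasure w) + Complex.I • volterra (weightedMeasure w) g ∧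
      (α - 1) * c = Complex.I * inner ℂ (oneL2 (weightedMeasure w)) g := by
  rw [LinearPMap.mem_graph_iff]
  constructor
  · rintro ⟨y, hy, hg⟩
    obtain ⟨c, hc⟩ := hw.mem_graph_maxOp.1 ((LinearPMap.mem_graph_iff _).2
      ⟨(⟨y, y.2.1⟩ : (maxOp hw).domain), hy, hg⟩)
    have ht : TwistedLimits α (y : L2w w) := y.2.2
    rw [hy] at ht
    dsimp only at ht
    rw [hc] at ht
    exact ⟨c, hc, hw.twistedLimits_iff.1 ht⟩
  · rintro ⟨c, hc, h⟩
    obtain ⟨y, hy, hg⟩ := (LinearPMap.mem_graph_iff _).1 (hw.mem_graph_maxOp.2 ⟨c, hc⟩)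
    refine ⟨⟨y, y.2, ?_⟩, hy, hg⟩
    rw [hy]
    dsimp only
    rw [hc]
    exact hw.twistedLimits_iff.2 h

/-- Functions in `D₀` vanish at `±∞`. -/
theorem IsWeight.of_mem_graph_Tw (hw : IsWeight w) {u g : L2w w} (h : (u, g) ∈ (Tw hw).graph) :
    u = Complex.I • volterra (weightedMeasure w) g ∧
      inner ℂ (oneL2 (weightedMeasure w)) g = 0 := by
  obtain ⟨y, rfl, hg⟩ := (LinearPMap.mem_graph_iff _).1 h
  dsimp only at hg ⊢
  obtain ⟨c, hc⟩ := hw.mem_graph_maxOp.1 ((LinearPMap.mem_graph_iff _).2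
    ⟨(⟨y, D0_le_maxDomain hw y.2⟩ : (maxOp hw).domain), rfl, hg⟩)
  have hL : MemLp (fun x => c + Complex.I * prim (weightedMeasure w) g x) 2 := by
    refine (memLp_congr_ae ?_).1 y.2.1.1
    rw [hc]
    exact hw.coeFn_const_add_volterra c g
  have hsq := (memLp_two_iff_integrable_sq_norm hL.1).1 hL
  have hbot : Tendsto (fun x => c + Complex.I * prim (weightedMeasure w) g x) atBot (𝓝 c) := by
    simpa using ((tendsto_prim_atBot (integrable_coeFn g)).const_mul Complex.I).const_add c
  have htop := ((tendsto_prim_atTop (integrable_coeFn g)).const_mul Complex.I).const_add c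
  -- Here `|u|²` is integrable for Lebesgue measure, so on a half-line of infinite measure its limit
  -- can only be `0`.
  have hc0 : c = 0 := by
    have := (hsq.integrableAtFilter atBot).eq_zero_of_tendsto (fun s hs => ?_) (hbot.norm.pow 2)
    · simpa using this
    · obtain ⟨a, ha⟩ := mem_atBot_sets.1 hs
      exact measure_mono_top (s₁ := Set.Iic a) ha Real.volume_Iic
  have hg0 : c + Complex.I * ∫ y, g y ∂(weightedMeasure w) = 0 := by
    have := (hsq.integrableAtFilter atTop).eq_zero_of_tendsto (fun s hs => ?_) (htop.norm.pow 2)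
    · simpa using this
    · obtain ⟨a, ha⟩ := mem_atTop_sets.1 hs
      exact measure_mono_top (s₁ := Set.Ici a) ha Real.volume_Ici
  rw [hc0, zero_add, ← inner_oneL2] at hg0
  refine ⟨?_, (mul_eq_zero.1 hg0).resolve_left Complex.I_ne_zero⟩
  simpa [hc0] using hc

/-- Primitives with compact support of functions in `L²_w` belong to `D₀`. -/
theorem IsWeight.mem_graph_Tw_of_bounded_support (hw : IsWeight w) {g : L2w w} {R : ℝ}
    (hR : ∀ᵐ x ∂(weightedMeasure w), x ∉ Set.Icc (-R) R → g x = 0)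
    (h0 : inner ℂ (oneL2 (weightedMeasure w)) g = 0) :
    (Complex.I • volterra (weightedMeasure w) g, g) ∈ (Tw hw).graph := by
  have hgi := integrable_coeFn g
  have hz : ∀ x, x ∉ Set.Icc (-R) R → prim (weightedMeasure w) g x = 0 := by
    intro x hx
    rcases lt_or_ge x (-R) with h | h
    · refine setIntegral_eq_zero_of_ae_eq_zero ?_
      filter_upwards [hR] with y hy hyx
      exact hy fun h' => absurd (h.trans_le h'.1) (not_lt.2 hyx)
    · have hx' : R < x := not_le.1 fun h' => hx ⟨h, h'⟩
      have h1 : ∫ y in Set.Ioi x, g y ∂(weightedMeasure w) = 0 := by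
        refine setIntegral_eq_zero_of_ae_eq_zero ?_
        filter_upwards [hR] with y hy hyx
        exact hy fun h' => absurd (hx'.trans hyx) h'.2.not_gt
      have h2 := integral_add_compl (measurableSet_Iic (a := x)) hgi
      rwa [Set.compl_Iic, h1, ← inner_oneL2, h0, add_zero] at h2
  have e0 : (0 : ℂ) • oneL2 (weightedMeasure w) + Complex.I • volterra (weightedMeasure w) g
      = Complex.I • volterra (weightedMeasure w) g := by rw [zero_smul, zero_add]
  have hae := hw.coeFn_const_add_volterra 0 g
  have hwd := hw.hasWeakDeriv_const_add_volterra 0 g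
  obtain ⟨y, hy, hg⟩ := (LinearPMap.mem_graph_iff _).1 (hw.mem_graph_maxOp.2 ⟨0, e0.symm⟩)
  refine (LinearPMap.mem_graph_iff _).2 ⟨⟨y, ?_⟩, hy, hg⟩
  rw [hy]
  dsimp only
  rw [e0] at hae hwd
  have hs := hw.memLp_sqrt_mul g
  have hsq : ∀ x, 0 < w x → (√(w x) : ℂ) * √(w x) = w x := fun x hx => by
    rw [← Complex.ofReal_mul, Real.mul_self_sqrt hx.le]
  refine ⟨⟨?_, ⟨_, hwd⟩, ?_⟩, ?_⟩
  · refine (memLp_congr_ae hae).2 (Continuous.memLp_of_hasCompactSupport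
      (continuous_const.add (continuous_const.mul (continuous_prim hgi)))
      (HasCompactSupport.intro (isCompact_Icc (a := -R) (b := R)) fun x hx => ?_))
    rw [hz x hx, mul_zero, add_zero]
  -- The weak derivative is `i √w · (√w g)`: a bounded factor, since `w ∈ L^∞`, times an `L²`
  -- function.
  · have hb : MemLp (fun x => Complex.I * (√(w x) : ℂ)) ∞ := by
      refine memLp_top_of_bound (C := √(eLpNorm w ∞ volume).toReal)
        ((Complex.continuous_ofReal.comp_aestronglyMeasurable
          (Real.continuous_sqrt.comp_aestronglyMeasurable hw.integrable.1)).const_mul _) ?_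
      have hbd := ae_le_eLpNormEssSup (f := w) (μ := volume)
      filter_upwards [hbd, hw.pos] with x hx hp
      rw [norm_mul, Complex.norm_I, one_mul, Complex.norm_real, Real.norm_eq_abs,
        abs_of_nonneg (Real.sqrt_nonneg _)]
      refine Real.sqrt_le_sqrt ?_
      rw [eLpNorm_exponent_top]
      have h3 := ENNReal.toReal_mono
        (by simpa [eLpNorm_exponent_top] using hw.bounded.2.ne) hx
      rwa [toReal_enorm, Real.norm_eq_abs, abs_of_pos hp] at h3
    refine (memLp_congr_ae ?_).1 (hs.mul hb)
    filter_upwards [hwd.weakDeriv_ae, hw.pos] with x hx hp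
    rw [hx, Pi.mul_apply, ← hsq x hp]
    ring
  -- Here `w^{-1/2} T u = w^{-1/2} w g = √w g`.
  · refine (memLp_congr_ae ?_).1 hs
    filter_upwards [hwd.weakDeriv_ae, hw.pos] with x hx hp
    have h1 : ((w x ^ (-(1 / 2) : ℝ) : ℝ) : ℂ) * √(w x) = 1 := by
      rw [← Complex.ofReal_mul, Real.sqrt_eq_rpow, ← Real.rpow_add hp]
      simp
    rw [momentum, hx, ← hsq x hp]
    linear_combination (-(√(w x) : ℂ) * g x) * h1
      + ((w x ^ (-(1 / 2) : ℝ) : ℝ) : ℂ) * √(w x) * √(w x) * g x * Complex.I_sq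

theorem dense_bounded_support : Dense {g : L2w w |
    ∃ R : ℝ, ∀ᵐ x ∂(weightedMeasure w), x ∉ Set.Icc (-R) R → g x = 0} := by
  intro g
  refine Metric.mem_closure_iff.2 fun ε hε => ?_
  obtain ⟨f, hfc, hfε, -, hf⟩ := (Lp.memLp g).exists_hasCompactSupport_eLpNorm_sub_le
    (by norm_num) (ENNReal.ofReal_pos.2 (half_pos hε)).ne'
  obtain ⟨R, hR⟩ := hfc.isCompact.isBounded.subset_closedBall 0
  rw [Real.closedBall_eq_Icc, zero_sub, zero_add] at hR
  refine ⟨hf.toLp f, ⟨R, ?_⟩, ?_⟩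
  · filter_upwards [hf.coeFn_toLp] with x hx hxR
    rw [hx]
    exact image_eq_zero_of_notMem_tsupport fun h => hxR (hR h)
  · have e : g - hf.toLp f = ((Lp.memLp g).sub hf).toLp ((g : ℝ → ℂ) - f) := by
      rw [MemLp.toLp_sub (Lp.memLp g) hf, Lp.toLp_coeFn]
    rw [dist_eq_norm, e, Lp.norm_toLp]
    refine lt_of_le_of_lt (ENNReal.toReal_le_of_le_ofReal (half_pos hε).le hfε) (half_lt_self hε)

/-- The closure of the graph of `T_w`. -/
theorem IsWeight.mem_closure_graph_Tw_iff (hw : IsWeight w) {u g : L2w w} :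
    (u, g) ∈ closure ((Tw hw).graph : Set (L2w w × L2w w)) ↔
      u = Complex.I • volterra (weightedMeasure w) g ∧
        inner ℂ (oneL2 (weightedMeasure w)) g = 0 := by
  have := hw.isOpenPosMeasure
  constructor
  · intro h
    have hcl : IsClosed {p : L2w w × L2w w | p.1 = Complex.I • volterra (weightedMeasure w) p.2 ∧
        inner ℂ (oneL2 (weightedMeasure w)) p.2 = 0} :=
      (isClosed_eq continuous_fst (by fun_prop)).inter (isClosed_eq (by fun_prop) continuous_const)
    exact closure_minimal (fun p hp => hw.of_mem_graph_Tw hp) hcl h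
  · rintro ⟨rfl, h0⟩
    let χ : L2w w := indicatorConstLp 2 (measurableSet_Icc (a := (0 : ℝ)) (b := 1))
      (measure_ne_top _ _) (1 : ℂ)
    let a : ℂ := inner ℂ (oneL2 (weightedMeasure w)) χ
    have ha : a ≠ 0 := by
      have h1 : a = (weightedMeasure w).real (Set.Icc 0 1) := by
        simp only [a, χ]
        rw [inner_oneL2, integral_congr_ae indicatorConstLp_coeFn,
          integral_indicator measurableSet_Icc, setIntegral_const, Complex.real_smul, mul_one]
      rw [h1, Complex.ofReal_ne_zero]
      refine (ENNReal.toReal_pos (ne_of_gt ?_) (measure_ne_top _ _)).ne'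
      exact (Measure.measure_Ioo_pos _ |>.2 zero_lt_one).trans_le
        (measure_mono Set.Ioo_subset_Icc_self)
    -- A continuous projection onto `1^⊥` that preserves bounded support and fixes `g`; it carries
    -- approximants of `g` with bounded support into those allowed by the previous lemma.
    let Φ : L2w w → L2w w := fun k => k - (inner ℂ (oneL2 (weightedMeasure w)) k / a) • χ
    have hΦ : Continuous Φ := by fun_prop
    have hg : Φ g = g := by simp only [Φ, h0, zero_div, zero_smul, sub_zero]
    have hm := map_mem_closure
      (f := fun k : L2w w => (Complex.I • volterra (weightedMeasure w) (Φ k), Φ k))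
      (t := ((Tw hw).graph : Set (L2w w × L2w w))) (by fun_prop) (dense_bounded_support g) ?_
    · simpa only [hg] using hm
    · rintro k ⟨R, hk⟩
      refine hw.mem_graph_Tw_of_bounded_support (R := max R 1) ?_ ?_
      · filter_upwards [hk, Lp.coeFn_sub k ((inner ℂ (oneL2 (weightedMeasure w)) k / a) • χ),
          Lp.coeFn_smul (inner ℂ (oneL2 (weightedMeasure w)) k / a) χ,
          indicatorConstLp_coeFn (μ := weightedMeasure w) (p := 2)
            (hs := measurableSet_Icc (a := (0 : ℝ)) (b := 1)) (hμs := measure_ne_top _ _)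
            (c := (1 : ℂ))] with x h1 h2 h3 h4 hx
        have h5 : x ∉ Set.Icc (0 : ℝ) 1 := fun h' => hx
          ⟨by linarith [h'.1, le_max_right R 1], h'.2.trans (le_max_right R 1)⟩
        have h6 : x ∉ Set.Icc (-R) R := fun h' => hx
          ⟨by linarith [h'.1, le_max_left R 1], h'.2.trans (le_max_left R 1)⟩
        rw [h2, Pi.sub_apply, h1 h6, h3, Pi.smul_apply]
        simp only [χ]
        rw [h4, Set.indicator_of_notMem h5, smul_zero, sub_zero]
      · simp only [Φ]
        rw [inner_sub_right, inner_smul_right, div_mul_cancel₀ _ ha, sub_self]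

end Domains

/-! ### Self-adjoint operators and resolvents -/

section OperatorTheory

variable {H : Type*} [NormedAddCommGroup H] [InnerProductSpace ℂ H]
  {A S : H →ₗ.[ℂ] H}

theorem isSymm_of_le (hS : IsSymm S) (h : A ≤ S) : IsSymm A := by
  intro x y
  have h1 := hS (Submodule.inclusion h.1 x) (Submodule.inclusion h.1 y)
  rwa [← h.2 (x := x) (y := Submodule.inclusion h.1 x) rfl,
    ← h.2 (x := y) (y := Submodule.inclusion h.1 y) rfl] at h1

/-- Lets compactness pass from the explicit resolvent to an arbitrary one. -/
theorem IsResolventAt.unique {z : ℂ} {R R' : H →L[ℂ] H} (h : IsResolventAt A z R)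
    (h' : IsResolventAt A z R') : R = R' := by
  ext y
  obtain ⟨x, hx, hy⟩ := h.1 y
  rw [← hx, ← h'.2 x, hy]

theorem pointSpectrum_subset_opSpectrum : pointSpectrum A ⊆ opSpectrum A := by
  rintro z ⟨v, ⟨x, rfl, hx⟩, hv⟩ ⟨R, hR⟩
  refine hv ?_
  rw [← hR.2 x, hx, sub_self, map_zero]

variable [CompleteSpace H]

/-- A densely defined symmetric operator with `Ran (A - t) = H` for a real `t` is
self-adjoint. -/
theorem IsSymm.isSelfAdjoint (hs : IsSymm A) (hd : Dense (A.domain : Set H)) (t : ℝ)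
    (hr : ∀ y : H, ∃ x : A.domain, A x - (t : ℂ) • (x : H) = y) : IsSelfAdjoint A := by
  have hle : A ≤ A.adjoint := LinearPMap.IsFormalAdjoint.le_adjoint hd hs
  rw [LinearPMap.isSelfAdjoint_def]
  refine (LinearPMap.eq_of_le_of_domain_eq hle (le_antisymm hle.1 fun y hy => ?_)).symm
  obtain ⟨x, hx⟩ := hr (A.adjoint ⟨y, hy⟩ - (t : ℂ) • y)
  -- With `(A - t) x = (A* - t) y` and `t` real, `y - x` is orthogonal to `Ran (A - t)`, which is
  -- everything.
  have h1 : y - (x : H) = 0 := by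
    obtain ⟨v, hv⟩ := hr (y - x)
    rw [← inner_self_eq_zero (𝕜 := ℂ)]
    nth_rw 2 [← hv]
    have h2 : inner ℂ (A.adjoint ⟨y, hy⟩) (v : H) = inner ℂ y (A v) :=
      LinearPMap.adjoint_isFormalAdjoint hd ⟨y, hy⟩ v
    have h3 := hs x v
    have h4 : inner ℂ (A x - (t : ℂ) • (x : H)) (v : H)
        = inner ℂ (A.adjoint ⟨y, hy⟩ - (t : ℂ) • y) (v : H) := by rw [hx]
    simp only [inner_sub_left, inner_sub_right, inner_smul_left, inner_smul_right,
      Complex.conj_ofReal] at h4 ⊢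
    linear_combination -h2 + h3 - h4
  rw [sub_eq_zero] at h1
  rw [h1]
  exact x.2

theorem closure_eq_of_isSelfAdjoint (hA : IsSelfAdjoint A) : A.closure = A := by
  refine LinearPMap.eq_of_eq_graph ?_
  rw [← hA.isClosed.isClosable.graph_closure_eq_closure_graph]
  exact IsClosed.submodule_topologicalClosure_eq hA.isClosed

theorem isEssentiallySelfAdjoint_of_isSelfAdjoint (hA : IsSelfAdjoint A) :
    IsEssentiallySelfAdjoint A :=
  ⟨hA.isClosed.isClosable, (closure_eq_of_isSelfAdjoint hA).symm ▸ hA⟩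

theorem isSymm_of_isSelfAdjoint (hA : IsSelfAdjoint A) : IsSymm A := by
  have h := LinearPMap.adjoint_isFormalAdjoint (T := A) hA.dense_domain
  rw [LinearPMap.isSelfAdjoint_def.1 hA] at h
  exact h

/-- Self-adjoint operators have no proper self-adjoint extensions. -/
theorem eq_of_isSelfAdjoint_of_le (hA : IsSelfAdjoint A) (hS : IsSelfAdjoint S) (h : A ≤ S) :
    S = A := by
  refine le_antisymm ?_ h
  have h1 : S ≤ A.adjoint := by
    refine LinearPMap.IsFormalAdjoint.le_adjoint hA.dense_domain fun x y => ?_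
    have h2 := isSymm_of_isSelfAdjoint hS (Submodule.inclusion h.1 x) y
    rwa [← h.2 (x := x) (y := Submodule.inclusion h.1 x) rfl] at h2
  rwa [LinearPMap.isSelfAdjoint_def.1 hA] at h1

/-- The eigenvectors of a symmetric operator with a compact resolvent at a real point span a
dense subspace. -/
theorem dense_span_eigenvectors (hs : IsSymm A) {t : ℝ} {R : H →L[ℂ] H}
    (hR : IsResolventAt A t R) (hc : IsCompactOperator R) :
    Dense (Submodule.span ℂ (⋃ z : ℂ, eigenvectors A z) : Set H) := by
  have hsymm : (R : H →ₗ[ℂ] H).IsSymmetric := by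
    intro y y'
    obtain ⟨x, hx, hy⟩ := hR.1 y
    obtain ⟨x', hx', hy'⟩ := hR.1 y'
    have h := hs x x'
    rw [ContinuousLinearMap.coe_coe, ← hx, ← hx']
    rw [← hy, ← hy', inner_sub_left, inner_sub_right, h, inner_smul_left, inner_smul_right,
      Complex.conj_ofReal]
  have h := ContinuousLinearMap.orthogonalComplement_iSup_eigenspaces_eq_bot hc hsymm
  rw [Submodule.dense_iff_topologicalClosure_eq_top, Submodule.topologicalClosure_eq_top_iff,
    eq_bot_iff, ← h]
  refine Submodule.orthogonal_le (iSup_le fun κ v hv => ?_)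
  rw [Module.End.mem_eigenspace_iff, ContinuousLinearMap.coe_coe] at hv
  obtain ⟨x, hx, hy⟩ := hR.1 v
  rcases eq_or_ne κ 0 with rfl | hκ
  · rw [zero_smul] at hv
    have hx0 : x = 0 := Subtype.ext (hx.trans hv)
    rw [← hy, hx0, LinearPMap.map_zero, Submodule.coe_zero, smul_zero, sub_zero]
    exact zero_mem _
  -- `R v = κ v` means `(A - t) (κ v) = v`, so `v` is an eigenvector of `A` for `t + κ⁻¹`.
  · refine Submodule.subset_span (Set.mem_iUnion.2 ⟨t + κ⁻¹, κ⁻¹ • x, ?_, ?_⟩)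
    · rw [Submodule.coe_smul, hx, hv, smul_smul, inv_mul_cancel₀ hκ, one_smul]
    · rw [LinearPMap.map_smul, eq_add_of_sub_eq hy, Submodule.coe_smul, hx, hv]
      simp only [smul_add, smul_smul, ← add_smul]
      congr 1
      field_simp
      ring

end OperatorTheory

/-! ### The twisted operators -/

section Twisted

variable {w : ℝ → ℝ} [IsFiniteMeasure (weightedMeasure w)]

/-- With `c`, `d` the limits of the two functions at `-∞`, the identity for `V + V*` reduces the
boundary form to `i (|α|² - 1) c̄ d`. -/
theorem IsWeight.isSymm_TwTwisted (hw : IsWeight w) {α : ℂ} (hα : ‖α‖ = 1) :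
    IsSymm (TwTwisted hw α) := by
  intro x y
  obtain ⟨c, hc, hc'⟩ := hw.mem_graph_TwTwisted.1 ((TwTwisted hw α).mem_graph x)
  obtain ⟨d, hd, hd'⟩ := hw.mem_graph_TwTwisted.1 ((TwTwisted hw α).mem_graph y)
  have h := inner_volterra_add (TwTwisted hw α x) (TwTwisted hw α y)
  generalize TwTwisted hw α x = g at *
  generalize TwTwisted hw α y = k at *
  rw [hc, hd]
  simp only [inner_add_left, inner_add_right, inner_smul_left, inner_smul_right, Complex.conj_I]
  have hα' : starRingEnd ℂ α * α = 1 := by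
    rw [← Complex.normSq_eq_conj_mul_self, Complex.normSq_eq_norm_sq, hα]
    simp
  have hcc := congrArg (starRingEnd ℂ) hc'
  simp only [map_mul, map_sub, map_one, Complex.conj_I, inner_conj_symm] at hcc
  generalize inner ℂ g (oneL2 (weightedMeasure w)) = a at *
  generalize inner ℂ (oneL2 (weightedMeasure w)) k = b at *
  have ha : a = Complex.I * ((starRingEnd ℂ α - 1) * starRingEnd ℂ c) := by
    rw [hcc, ← mul_assoc, mul_neg, Complex.I_mul_I, neg_neg, one_mul]
  have hb : b = -Complex.I * ((α - 1) * d) := by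
    rw [hd', ← mul_assoc, neg_mul, Complex.I_mul_I, neg_neg, one_mul]
  rw [ha, hb] at h ⊢
  linear_combination Complex.I * h
    - (Complex.I ^ 3) * (starRingEnd ℂ c * d) * hα'
    + d * Complex.I * starRingEnd ℂ c * (starRingEnd ℂ α + α - 2) * Complex.I_sq

variable [(weightedMeasure w).IsOpenPosMeasure]

/-- The condition on the spectral parameter `z` for an eigenvector of `T_w^α`. -/
theorem IsWeight.expL2_mem_graph (hw : IsWeight w) {α z : ℂ}
    (h : Complex.exp (Complex.I * z * (weightedMeasure w).real Set.univ) = α) :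
    (expL2 (weightedMeasure w) z, z • expL2 (weightedMeasure w) z) ∈ (TwTwisted hw α).graph := by
  refine hw.mem_graph_TwTwisted.2 ⟨1, ?_, ?_⟩
  · rw [one_smul, map_smul, smul_smul]
    exact expL2_eq z
  · rw [← h, exp_eq_inner_expL2, inner_smul_right]
    ring

/-- The difference `u - c E_z` solves the homogeneous Volterra equation, so `u = c E_z`; the
boundary condition then says `c (exp (i z m) - α) = 0`. -/
theorem IsWeight.eq_zero_of_mem_graph (hw : IsWeight w) {α z : ℂ}
    (h : Complex.exp (Complex.I * z * (weightedMeasure w).real Set.univ) ≠ α) {u : L2w w}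
    (hu : (u, z • u) ∈ (TwTwisted hw α).graph) : u = 0 := by
  obtain ⟨c, hc, hc'⟩ := hw.mem_graph_TwTwisted.1 hu
  have h1 : u - c • expL2 (weightedMeasure w) z = 0 := by
    refine eq_zero_of_eq_smul_volterra (z := z) ?_
    rw [map_smul, smul_smul] at hc
    conv_lhs => rw [hc, expL2_eq z]
    rw [map_sub, map_smul, smul_sub, smul_add, smul_smul, smul_smul, mul_comm c (Complex.I * z)]
    abel
  rw [sub_eq_zero] at h1
  have h2 : c = 0 := by
    rw [h1, inner_smul_right, inner_smul_right] at hc'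
    have h3 := exp_eq_inner_expL2 (μ := weightedMeasure w) z
    have h4 : c * (Complex.exp (Complex.I * z * (weightedMeasure w).real Set.univ) - α) = 0 := by
      linear_combination c * h3 - hc'
    exact (mul_eq_zero.1 h4).resolve_right (sub_ne_zero.2 h)
  rw [h1, h2, zero_smul]

/-- The resolvent of `T_w^α` exists outside the eigenvalues and is compact. -/
theorem IsWeight.exists_resolvent (hw : IsWeight w) {α z : ℂ}
    (h : Complex.exp (Complex.I * z * (weightedMeasure w).real Set.univ) ≠ α) :
    ∃ R : L2w w →L[ℂ] L2w w, IsCompactOperator R ∧ IsResolventAt (TwTwisted hw α) z R := by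
  obtain ⟨B, hB⟩ := exists_equiv_one_sub_volterra (μ := weightedMeasure w) z
  have hne := sub_ne_zero.2 h.symm
  have hE := exp_eq_inner_expL2 (μ := weightedMeasure w) z
  have hEq := expL2_eq (μ := weightedMeasure w) z
  set e := Complex.exp (Complex.I * z * (weightedMeasure w).real Set.univ)
  set E := expL2 (weightedMeasure w) z
  set V := volterra (weightedMeasure w)
  -- Inserting `u = c + i V g` into `g - z u = y` gives `B g = y + z c · 1`. As `B E = 1`, this
  -- yields `g = b + z c E` with `b = B⁻¹ y`, hence `u = i V b + c E`. The boundary condition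
  -- determines `c (α - e) = i ⟪1, b⟫`.
  let R : L2w w →L[ℂ] L2w w := Complex.I • V.comp (B.symm : L2w w →L[ℂ] L2w w) +
    (Complex.I / (α - e)) • (ContinuousLinearMap.toSpanSingleton ℂ E).comp
      ((innerSL ℂ (oneL2 (weightedMeasure w))).comp (B.symm : L2w w →L[ℂ] L2w w))
  have hc : IsCompactOperator R := by
    refine IsCompactOperator.add (IsCompactOperator.smul ?_ Complex.I)
      (IsCompactOperator.smul ?_ (Complex.I / (α - e)))
    · exact isCompactOperator_volterra.comp_clm (B.symm : L2w w →L[ℂ] L2w w)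
    · exact (isCompactOperator_of_locallyCompactSpace_dom
        ((innerSL ℂ (oneL2 (weightedMeasure w))).comp (B.symm : L2w w →L[ℂ] L2w w))).clm_comp
        (ContinuousLinearMap.toSpanSingleton ℂ E)
  have hR : ∀ y, ∃ x : (TwTwisted hw α).domain, (x : L2w w) = R y ∧
      TwTwisted hw α x - z • (x : L2w w) = y := by
    intro y
    set b := B.symm y
    have hb : b - (Complex.I * z) • V b = y := by rw [← hB, B.apply_symm_apply]
    let c : ℂ := Complex.I / (α - e) * inner ℂ (oneL2 (weightedMeasure w)) b
    have hcdef : c * (α - e) = Complex.I * inner ℂ (oneL2 (weightedMeasure w)) b := by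
      simp only [c]
      field_simp
    have hRy : R y = Complex.I • V b + c • E := by
      simp only [R, c, mul_smul]
      rfl
    have hg : (R y, b + (z * c) • E) ∈ (TwTwisted hw α).graph := by
      refine hw.mem_graph_TwTwisted.2 ⟨c, ?_, ?_⟩
      · rw [hRy]
        conv_lhs => rw [hEq]
        rw [map_add, map_smul, smul_add, smul_add, smul_smul, smul_smul,
          show c * (Complex.I * z) = Complex.I * (z * c) by ring]
        abel
      · rw [inner_add_right, inner_smul_right]
        linear_combination hcdef + c * hE
    obtain ⟨x, hx, hx'⟩ := (LinearPMap.mem_graph_iff _).1 hg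
    refine ⟨x, hx, ?_⟩
    rw [hx, hx']
    dsimp only
    rw [hRy, ← hb, smul_add, smul_smul, smul_smul, mul_comm z Complex.I]
    abel
  refine ⟨R, hc, hR, fun x => ?_⟩
  obtain ⟨x', hx', h'⟩ := hR (TwTwisted hw α x - z • (x : L2w w))
  have h0 : ((x' - x : (TwTwisted hw α).domain) : L2w w) = 0 := by
    refine hw.eq_zero_of_mem_graph h ((LinearPMap.mem_graph_iff _).2 ⟨x' - x, rfl, ?_⟩)
    rw [LinearPMap.map_sub, Submodule.coe_sub, smul_sub]
    dsimp only
    rw [sub_eq_sub_iff_sub_eq_sub]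
    exact h'
  rw [← hx']
  exact sub_eq_zero.1 h0

theorem IsWeight.pointSpectrum_TwTwisted (hw : IsWeight w) (α : ℂ) :
    pointSpectrum (TwTwisted hw α)
      = {z | Complex.exp (Complex.I * z * (weightedMeasure w).real Set.univ) = α} := by
  ext z
  constructor
  · rintro ⟨v, ⟨x, rfl, hx⟩, hv⟩
    by_contra h
    exact hv (hw.eq_zero_of_mem_graph h ((LinearPMap.mem_graph_iff _).2 ⟨x, rfl, hx⟩))
  · intro h
    obtain ⟨x, hx, hx'⟩ := (LinearPMap.mem_graph_iff _).1 (hw.expL2_mem_graph h)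
    exact ⟨_, ⟨x, hx, by rw [hx', hx]⟩, expL2_ne_zero z⟩

theorem IsWeight.opSpectrum_TwTwisted (hw : IsWeight w) (α : ℂ) :
    opSpectrum (TwTwisted hw α) = pointSpectrum (TwTwisted hw α) := by
  refine Set.Subset.antisymm (fun z hz => ?_) pointSpectrum_subset_opSpectrum
  rw [hw.pointSpectrum_TwTwisted]
  by_contra h
  obtain ⟨R, -, hR⟩ := hw.exists_resolvent h
  exact hz ⟨R, hR⟩

theorem weightedMeasure_real_univ_pos :
    0 < (weightedMeasure w).real Set.univ := by
  refine ENNReal.toReal_pos ?_ (measure_ne_top _ _)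
  exact (isOpen_univ.measure_pos _ Set.univ_nonempty).ne'

/-- Some real number is not an eigenvalue. -/
theorem exists_real_exp_ne (α : ℂ) : ∃ t : ℝ,
    Complex.exp (Complex.I * t * (weightedMeasure w).real Set.univ) ≠ α := by
  rcases ne_or_eq 1 α with h | rfl
  · exact ⟨0, by simpa using h⟩
  -- At `t = π / m` the exponential is `-1`.
  · refine ⟨Real.pi / (weightedMeasure w).real Set.univ, ?_⟩
    have hm : ((weightedMeasure w).real Set.univ : ℂ) ≠ 0 :=
      Complex.ofReal_ne_zero.2 weightedMeasure_real_univ_pos.ne'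
    rw [Complex.ofReal_div, mul_assoc, div_mul_cancel₀ _ hm, mul_comm, Complex.exp_pi_mul_I]
    norm_num

end Twisted

/-! ### The minimal operator -/

section Minimal

variable {w : ℝ → ℝ} [IsFiniteMeasure (weightedMeasure w)]

theorem IsWeight.Tw_le_TwTwisted (hw : IsWeight w) (α : ℂ) : Tw hw ≤ TwTwisted hw α := by
  refine LinearPMap.le_of_le_graph ?_
  rintro ⟨u, g⟩ h
  obtain ⟨h1, h2⟩ := hw.of_mem_graph_Tw h
  exact hw.mem_graph_TwTwisted.2 ⟨0, by rw [h1, zero_smul, zero_add], by rw [h2]; simp⟩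

/-- If `v` is orthogonal to the domain, then `⟪V g, v⟫ = 0` for all `g ⟂ 1`, so by the identity for
`V + V*` also `⟪g, V v⟫ = 0`. Thus `V v` is a constant, and the maximal operator sends `0` to `v`,
so `v = 0`. -/
theorem IsWeight.dense_domain_Tw (hw : IsWeight w) : Dense ((Tw hw).domain : Set (L2w w)) := by
  rw [Submodule.dense_iff_topologicalClosure_eq_top, Submodule.topologicalClosure_eq_top_iff,
    eq_bot_iff]
  intro v hv
  have h1 : volterra (weightedMeasure w) v ∈ (ℂ ∙ oneL2 (weightedMeasure w))ᗮᗮ := by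
    intro g hg
    have h0 : inner ℂ (oneL2 (weightedMeasure w)) g = 0 :=
      Submodule.mem_orthogonal_singleton_iff_inner_right.1 hg
    have hcl := hw.mem_closure_graph_Tw_iff.2 ⟨rfl, h0⟩
    have hcl' : Complex.I • volterra (weightedMeasure w) g ∈
        closure ((Tw hw).domain : Set (L2w w)) :=
      map_mem_closure (f := Prod.fst) continuous_fst hcl fun p hp =>
        LinearPMap.mem_domain_of_mem_graph hp
    have h2 : inner ℂ (Complex.I • volterra (weightedMeasure w) g) v = 0 := by
      rw [← Submodule.orthogonal_closure] at hv
      exact hv _ hcl'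
    rw [inner_smul_left, mul_eq_zero] at h2
    have h3 := inner_volterra_add g v
    rw [h2.resolve_left (by simp), ← inner_conj_symm g (oneL2 _), h0] at h3
    simpa using h3
  rw [Submodule.orthogonal_orthogonal, Submodule.mem_span_singleton] at h1
  obtain ⟨c, hc⟩ := h1
  have h2 : ((0 : L2w w), v) ∈ (maxOp hw).graph :=
    hw.mem_graph_maxOp.2 ⟨-(Complex.I * c), by rw [← hc, smul_smul, neg_smul, neg_add_cancel]⟩
  exact LinearPMap.graph_fst_eq_zero_snd _ h2 rfl

variable [(weightedMeasure w).IsOpenPosMeasure]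

theorem IsWeight.isSelfAdjoint_TwTwisted (hw : IsWeight w) {α : ℂ} (hα : ‖α‖ = 1) :
    IsSelfAdjoint (TwTwisted hw α) := by
  obtain ⟨t, ht⟩ := exists_real_exp_ne (w := w) α
  obtain ⟨R, -, hR⟩ := hw.exists_resolvent ht
  refine (hw.isSymm_TwTwisted hα).isSelfAdjoint
    (hw.dense_domain_Tw.mono (hw.Tw_le_TwTwisted α).1) t fun y => ?_
  obtain ⟨x, -, hx⟩ := hR.1 y
  exact ⟨x, hx⟩

theorem IsWeight.isClosable_Tw (hw : IsWeight w) : (Tw hw).IsClosable :=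
  (hw.isSelfAdjoint_TwTwisted norm_one).isClosed.isClosable.leIsClosable (hw.Tw_le_TwTwisted 1)

theorem IsWeight.mem_graph_closure_Tw (hw : IsWeight w) {u g : L2w w} :
    (u, g) ∈ (Tw hw).closure.graph ↔ u = Complex.I • volterra (weightedMeasure w) g ∧
        inner ℂ (oneL2 (weightedMeasure w)) g = 0 := by
  rw [← hw.isClosable_Tw.graph_closure_eq_closure_graph]
  exact hw.mem_closure_graph_Tw_iff

/-- Otherwise the self-adjoint extensions for `α = 1` and `α = -1` would both equal the closure, but
`0` is an eigenvalue of the first only. -/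
theorem IsWeight.not_isEssentiallySelfAdjoint_Tw (hw : IsWeight w) :
    ¬ IsEssentiallySelfAdjoint (Tw hw) := by
  rintro ⟨-, h⟩
  have key : ∀ α : ℂ, ‖α‖ = 1 → TwTwisted hw α = (Tw hw).closure := fun α hα => by
    have hA := hw.isSelfAdjoint_TwTwisted hα
    refine eq_of_isSelfAdjoint_of_le h hA ?_
    rw [← closure_eq_of_isSelfAdjoint hA]
    exact hA.isClosed.isClosable.closure_mono (hw.Tw_le_TwTwisted α)
  have h1 := hw.pointSpectrum_TwTwisted 1
  rw [(key 1 norm_one).trans (key (-1) (by simp)).symm, hw.pointSpectrum_TwTwisted] at h1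
  have h2 : (0 : ℂ) ∈ {z : ℂ |
      Complex.exp (Complex.I * z * (weightedMeasure w).real Set.univ) = 1} := by simp
  rw [← h1] at h2
  norm_num at h2

/-- On the closure `u = i V g` with `g ⟂ 1`, so `g - z u = (1 - i z V) g`: the range is the image of
a hyperplane under an isomorphism, for every complex `z`. -/
theorem IsWeight.deficiency_closure_Tw (hw : IsWeight w) (z : ℂ) :
    deficiency (shift (Tw hw).closure z) = 1 := by
  obtain ⟨B, hB⟩ := exists_equiv_one_sub_volterra (μ := weightedMeasure w) z
  let ℓ : L2w w →ₗ[ℂ] ℂ := (innerSL ℂ (oneL2 (weightedMeasure w))).toLinearMap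
  have hker : ∀ g, g ∈ LinearMap.ker ℓ ↔ inner ℂ (oneL2 (weightedMeasure w)) g = 0 :=
    fun g => LinearMap.mem_ker
  have hmap : (LinearMap.ker ℓ).map (B.toLinearEquiv : L2w w →ₗ[ℂ] L2w w)
      = LinearMap.range (shift (Tw hw).closure z).toFun := by
    ext y
    rw [Submodule.mem_map, LinearMap.mem_range]
    constructor
    · rintro ⟨g, hg, rfl⟩
      obtain ⟨x, hx, hx'⟩ := (LinearPMap.mem_graph_iff _).1
        (hw.mem_graph_closure_Tw.2 ⟨rfl, (hker g).1 hg⟩)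
      refine ⟨x, ?_⟩
      change (Tw hw).closure x - z • (x : L2w w) = B g
      rw [hx, hx', hB]
      dsimp only
      rw [smul_smul, mul_comm]
    · rintro ⟨x, rfl⟩
      obtain ⟨h1, h2⟩ := hw.mem_graph_closure_Tw.1 ((Tw hw).closure.mem_graph x)
      refine ⟨(Tw hw).closure x, (hker _).2 h2, ?_⟩
      change B _ = (Tw hw).closure x - z • (x : L2w w)
      rw [hB]
      conv_rhs => rw [h1]
      rw [smul_smul, mul_comm]
  have hsurj : Function.Surjective ℓ := by
    refine LinearMap.surjective fun h => ?_
    have h1 : ℓ (oneL2 (weightedMeasure w)) = 0 := by rw [h, LinearMap.zero_apply]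
    exact oneL2_ne_zero (inner_self_eq_zero.1 h1)
  have e := (Submodule.Quotient.equiv _ _ B.toLinearEquiv hmap).symm.trans
    (ℓ.quotKerEquivOfSurjective hsurj)
  rw [deficiency, e.rank_eq, Module.rank_self]

end Minimal

end WeightedMomentum

open WeightedMomentum in
theorem mainTheorem6 (w : ℝ → ℝ) (hw : IsWeight w) :
    (Dense ((Tw hw).domain : Set (L2w w)) ∧ IsSymm (Tw hw) ∧ (Tw hw).IsClosable ∧
      ¬ IsEssentiallySelfAdjoint (Tw hw) ∧ deficiencyIndex (Tw hw) = (1, 1)) ∧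
    ∀ α : ℂ, ‖α‖ = 1 →
      IsEssentiallySelfAdjoint (TwTwisted hw α) ∧
      (∀ S : L2w w →ₗ.[ℂ] L2w w, IsSelfAdjoint S → TwTwisted hw α ≤ S →
        S = (TwTwisted hw α).closure) ∧
      HasCompactResolvent (TwTwisted hw α).closure ∧
      HasPurePointSpectrum (TwTwisted hw α).closure ∧
      ∀ β : ℝ, α = Complex.exp (β * Complex.I) →
        opSpectrum (TwTwisted hw α).closure =
          Set.range fun k : ℤ => (((∫ x, |w x|)⁻¹ * (β + 2 * Real.pi * k) : ℝ) : ℂ) := by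
  have := hw.isFiniteMeasure
  have := hw.isOpenPosMeasure
  refine ⟨⟨hw.dense_domain_Tw,
    isSymm_of_le (hw.isSymm_TwTwisted norm_one) (hw.Tw_le_TwTwisted 1), hw.isClosable_Tw,
    hw.not_isEssentiallySelfAdjoint_Tw,
    Prod.ext (hw.deficiency_closure_Tw _) (hw.deficiency_closure_Tw _)⟩, fun α hα => ?_⟩
  have hA := hw.isSelfAdjoint_TwTwisted hα
  -- `T_w^α` is already self-adjoint on `D₁^α`, so passing to the closure changes nothing.
  rw [closure_eq_of_isSelfAdjoint hA]
  obtain ⟨t, ht⟩ := exists_real_exp_ne (w := w) α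
  obtain ⟨R, hc, hR⟩ := hw.exists_resolvent ht
  refine ⟨isEssentiallySelfAdjoint_of_isSelfAdjoint hA,
    fun S hS h => eq_of_isSelfAdjoint_of_le hA hS h,
    ⟨⟨t, fun h => h ⟨R, hR⟩⟩, fun z R' hR' => ?_⟩,
    ⟨hw.opSpectrum_TwTwisted α, dense_span_eigenvectors (hw.isSymm_TwTwisted hα) hR hc⟩,
    fun β hβ => ?_⟩
  · have hz : Complex.exp (Complex.I * z * (weightedMeasure w).real Set.univ) ≠ α := by
      intro h
      have h1 : z ∈ opSpectrum (TwTwisted hw α) := by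
        rw [hw.opSpectrum_TwTwisted, hw.pointSpectrum_TwTwisted]
        exact h
      exact h1 ⟨R', hR'⟩
    obtain ⟨R'', hc'', hR''⟩ := hw.exists_resolvent hz
    rwa [hR'.unique hR'']
  · have hm : ((weightedMeasure w).real Set.univ : ℂ) ≠ 0 :=
      Complex.ofReal_ne_zero.2 weightedMeasure_real_univ_pos.ne'
    rw [hw.opSpectrum_TwTwisted, hw.pointSpectrum_TwTwisted, hβ, ← hw.measureReal_univ]
    ext z
    rw [Set.mem_ofPred_eq, Complex.exp_eq_exp_iff_exists_int, Set.mem_range]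
    refine exists_congr fun k => ?_
    push_cast
    rw [inv_mul_eq_iff_eq_mul₀ hm]
    constructor
    · intro h
      refine mul_left_cancel₀ Complex.I_ne_zero ?_
      linear_combination -h
    · intro h
      linear_combination (-Complex.I) * h
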